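/- **Setting.** Write $\mathcal F_1$ for the class of densities $g_1>0$ on $\mathbb R$ that satisfy the following conditions. * They are symmetric, $g_1(-z)=g_1(z)$, and standardized by $\int_{-\infty}^1 g_1=3/4$. * They are absolutely continuous with derivative $\dot g_1$, and the score $\varphi_{g_1}:=-\dot g_1/g_1$ is monotone increasing. * $\int z^4\varphi_{g_1}^2g_1\,dz<\infty$. * For some $\beta>0$, $\int_y^\infty g_1=O(y^{-\beta})$ as $y\to\infty$ and $\varphi_{g_1}(z)=o(z^{\beta/2-2})$ as $z\to\infty$. Let $\phi_1(z)=\sqrt{a/2\pi}\,e^{-az^2/2}$, with $a>0$ such that $\int_{-\infty}^1\phi_1=3/4$. Let $\mathcal F_{\phi_1}$ be the class of $g_1\in\mathcal F_1$ with $\int z^4\varphi_{\phi_1}^2(z)\,g_1(z)\,dz=a^2\int z^6g_1(z)\,dz<\infty$ (finite sixth moment). Put $\mu_k=\mu_k(g_1)=\int z^kg_1(z)\,dz$ and $\kappa(g_1)=\int z^2\varphi_{g_1}^2g_1\,dz\big/\int\varphi_{g_1}^2g_1\,dz$. For $\theta,\xi\in\mathbb R$ and $\sigma>0$, let $P^{(n)}_{\theta,\sigma,\xi;g_1}$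 be the law of $n$ i.i.d. observations $X_1,\dots,X_n$ with the Edgeworth density $$x\mapsto \sigma^{-1}\Big[g_1(u)+\max\big(-g_1(u),\min\big(g_1(u),\,-\xi\,\dot g_1(u)(u^2-\kappa(g_1))\big)\big)\Big],\qquad u=\frac{x-\theta}{\sigma}.$$ Let $m_k(\theta)=n^{-1}\sum_{i=1}^n(X_i-\theta)^k$, and $$S_1=\frac{n^{1/2}m_3(\theta)}{m_6(\theta)^{1/2}},\qquad T^\dagger(\theta)=\frac{\sum_{i=1}^n(X_i-\theta)\big((X_i-\theta)^2-3m_2(\theta)\big)}{\sqrt{n\,\big(m_6(\theta)-6m_2(\theta)m_4(\theta)+9m_2(\theta)^3\big)}}.$$ **Proposition.** Let $\theta\in\mathbb R$ and $\sigma>0$. 1. Let $g_1\in\mathcal F_{\phi_1}$. As $n\to\infty$, $S_1$ converges in distribution to $N(0,1)$ under $P^{(n)}_{\theta,\sigma,0;g_1}$. For every $\tau\in\mathbb R$, it converges in distribution to $$N\!\left(\tau\,\frac{5\mu_4-3\kappa(g_1)\mu_2}{\mu_6^{1/2}},\;1\right)\quad\text{under } P^{(n)}_{\theta,\sigma,n^{-1/2}\tau;g_1}.$$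 2. Let $z\in\mathbb R$ and $\alpha=1-\Phi(z)$, with $\Phi$ the standard normal distribution function. The test that rejects when $S_1>z$ has asymptotic level $\alpha$ for the null hypothesis of symmetry with respect to $\theta$: the upper limit of its rejection probability under $P^{(n)}_{\theta,\sigma',0;g_1}$ is at most $\alpha$ for all $\sigma'>0$ and $g_1\in\mathcal F_{\phi_1}$. It is suboptimal at the Gaussian: it is not locally asymptotically most powerful at asymptotic level $\alpha$ against the alternatives $P^{(n)}_{\theta,\sigma',\xi;\phi_1}$, $\xi>0$, $\sigma'>0$. That is, there are another sequence of (possibly randomized) tests of asymptotic level $\alpha$ and $\sigma',\tau>0$ such that, under $P^{(n)}_{\theta,\sigma',n^{-1/2}\tau;\phi_1}$, the power of these tests minus that of the $S_1$-test has a strictly positive upper limit. 3. In the Gaussian family $P^{(n)}_{\theta,\sigma,\xi;\phi_1}$, the asymptotic relative efficiency of $T^\dagger(\theta)$ with respect to $S_1$, for testing $\xi=0$ against $\xi>0$, is $5/2$. That is, for every $\alpha\in(0,1)$ the tests rejecting when $T^\dagger(\theta)>z$ and when $S_1>z$, with $z=\Phi^{-1}(1-\alpha)$, have null rejection probabilities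 tending to $\alpha$. Moreover, for each $\tau>0$, the $T^\dagger(\theta)$-test with $n$ observations has, at $\xi=n^{-1/2}\tau$, a limiting power $\beta\in(\alpha,1)$. Finally, whenever $N_n/n\to r\in(0,\infty)$, the $S_1$-test with $N_n$ observations has the same limiting power $\beta$ at $\xi=n^{-1/2}\tau$ if and only if $r=5/2$. -/

import Mathlib

open MeasureTheory ProbabilityTheory Filter Topology Asymptotics
open scoped ENNReal

namespace Edgeworth

noncomputable section

/-! ### Standardized symmetric densities

Throughout, `f` is a density on the line and `f'` is a version of its almost everywhere derivative. -/

/-- The score `φ_f = - f' / f`. -/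
def score (f f' : ℝ → ℝ) (z : ℝ) : ℝ := -f' z / f z

/-- `𝓘(f) = ∫ φ_f² f` (information for location). -/
def infoI (f f' : ℝ → ℝ) : ℝ := ∫ z, score f f' z ^ 2 * f z

/-- `𝓙(f) = ∫ z² φ_f² f` (information for scale). -/
def infoJ (f f' : ℝ → ℝ) : ℝ := ∫ z, z ^ 2 * score f f' z ^ 2 * f z

/-- The generalized kurtosis coefficient `κ(f) = 𝓙(f) / 𝓘(f)`. -/
def kappa (f f' : ℝ → ℝ) : ℝ := infoJ f f' / infoI f f'

/-- The moment `μ_k(f) = ∫ z^k f(z) dz`. -/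
def moment (k : ℕ) (f : ℝ → ℝ) : ℝ := ∫ z, z ^ k * f z

/-- The class `𝓕₀` of symmetric probability densities (positive and integrable with integral one)
whose median of absolute values is `1`. -/
structure IsStdSymmDensity (f : ℝ → ℝ) : Prop where
  pos : ∀ z, 0 < f z
  integrable : Integrable f
  integral_eq_one : ∫ z, f z = 1
  symm : ∀ z, f (-z) = f z
  std : ∫ z in Set.Iic (1 : ℝ), f z = 3 / 4

/-- The class `𝓕₁`: standardized symmetric densities `f` that are absolutely continuous (with
derivative `f'`), strongly unimodal, with finite information for asymmetry, and with
polynomial tails. -/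
structure IsRegularDensity (f f' : ℝ → ℝ) : Prop extends IsStdSymmDensity f where
  abs_cont : ∀ z₁ z₂, IntervalIntegrable f' volume z₁ z₂ ∧ f z₂ - f z₁ = ∫ z in z₁..z₂, f' z
  strongly_unimodal : Monotone (score f f')
  finite_info : Integrable fun z => z ^ 4 * score f f' z ^ 2 * f z
  tails : ∃ β : ℝ, 0 < β ∧
    (fun y : ℝ => ∫ z in Set.Ioi y, f z) =O[atTop] (fun y : ℝ => y ^ (-β)) ∧
    score f f' =o[atTop] fun z : ℝ => z ^ (β / 2 - 2)

/-- The class `𝓕_f` of the `g ∈ 𝓕₁` with `𝓚_g(f) = ∫ z⁴ φ_f² g < ∞`. -/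
structure IsRegularFor (f f' g g' : ℝ → ℝ) : Prop extends IsRegularDensity g g' where
  finite_crossInfo : Integrable fun z => z ^ 4 * score f f' z ^ 2 * g z

/-- The centered Gaussian density `z ↦ √(a / 2π) exp(- a z² / 2)`; the standardized one, `φ₁`, is
the one whose `a` puts it in `𝓕₀`. -/
def gaussDensity (a z : ℝ) : ℝ := Real.sqrt (a / (2 * Real.pi)) * Real.exp (-(a * z ^ 2 / 2))

/-! ### The Edgeworth families of asymmetric densities -/

/-- The Edgeworth density with location `θ`, scale `σ` and skewness parameter `ξ`: with
`u = (x - θ) / σ`, the term `- ξ f'(u) (u² - κ(f))` is added to `f(u)`, truncated to the interval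
`[-f(u), f(u)]`. The truncation is active exactly beyond the point `|z*|` at which
`f(z*) = ξ f'(z*) (z*² - κ(f))`, see `edgeworthDensity_eq`. -/
def edgeworthDensity (f f' : ℝ → ℝ) (θ σ ξ x : ℝ) : ℝ :=
  σ⁻¹ * (f ((x - θ) / σ) + max (-f ((x - θ) / σ)) (min (f ((x - θ) / σ))
    (-ξ * f' ((x - θ) / σ) * (((x - θ) / σ) ^ 2 - kappa f f'))))

/-- For small `ξ` the Edgeworth density is given explicitly in terms of the solution `z*` of
`f(z*) = ξ f'(z*) (z*² - κ(f))`. -/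
theorem edgeworthDensity_eq (f f' : ℝ → ℝ) (hf : IsRegularDensity f f')
    (hodd : ∀ z, f' (-z) = -f' z) (θ σ ξ zs x : ℝ) (hσ : 0 < σ)
    (hsmall : |ξ| * (score f f' (Real.sqrt (kappa f f')) * kappa f f') < 1)
    (hzs : f zs = ξ * f' zs * (zs ^ 2 - kappa f f')) :
    edgeworthDensity f f' θ σ ξ x =
      σ⁻¹ * f ((x - θ) / σ)
        - (if |x - θ| ≤ σ * |zs| then
            ξ * σ⁻¹ * f' ((x - θ) / σ) * (((x - θ) / σ) ^ 2 - kappa f f') else 0)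
        + Real.sign ξ * σ⁻¹ * f ((x - θ) / σ) *
          ((if x - θ > σ * |zs| then 1 else 0) - (if x - θ < -(σ * |zs|) then 1 else 0)) := by
  set u := (x - θ) / σ with hu
  set κ := kappa f f' with hκ
  have hxu : x - θ = σ * u := by rw [hu]; field_simp
  have hκ0 : 0 ≤ κ := by
    have hp := hf.pos
    refine div_nonneg (integral_nonneg fun z => ?_) (integral_nonneg fun z => ?_)
    · have := (hp z).le
      simp only [Pi.zero_apply]; positivity
    · have := (hp z).le
      simp only [Pi.zero_apply]; positivity
  have hs : ∀ z, score f f' (-z) = -score f f' z := fun z => by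
    simp only [score, hodd, hf.symm, neg_div]
  have hs0 : score f f' 0 = 0 := by have := hs 0; rw [neg_zero] at this; linarith
  have hmono := hf.strongly_unimodal
  have hsnn : ∀ z, 0 ≤ z → 0 ≤ score f f' z := fun z hz => hs0 ▸ hmono hz
  have hf' : ∀ z, f' z = -(score f f' z * f z) := fun z => by
    have := (hf.pos z).ne'
    simp only [score]; field_simp
  have hξ : 0 < |ξ| := by
    rw [abs_pos]; rintro rfl
    have := hf.pos zs; rw [hzs] at this; simp at this
  have hsabs : ∀ z, |score f f' z| = score f f' |z| := fun z => by
    rcases le_total 0 z with h | h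
    · rw [abs_of_nonneg h, abs_of_nonneg (hsnn z h)]
    · have := hsnn (-z) (by linarith)
      rw [abs_of_nonpos h, abs_of_nonpos (by rw [hs] at this; linarith), hs]
  have hc : |ξ| * score f f' |zs| * |(|zs|) ^ 2 - κ| = 1 := by
    have h1 : ξ * score f f' zs * (zs ^ 2 - κ) = -1 := by
      have h2 := hf.pos zs
      have h3 : f zs * (ξ * score f f' zs * (zs ^ 2 - κ)) = f zs * (-1) := by
        rw [hf' zs] at hzs; linarith
      exact mul_left_cancel₀ h2.ne' h3
    rw [← hsabs, sq_abs, ← abs_mul, ← abs_mul, h1]; simp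
  obtain ⟨w, hw⟩ : ∃ w, w = |zs| := ⟨_, rfl⟩
  rw [← hw] at hc ⊢
  have hw0 : 0 ≤ w := hw ▸ abs_nonneg zs
  have hmid : ∀ v, 0 ≤ v → v ^ 2 ≤ κ → |ξ| * score f f' v * |v ^ 2 - κ| < 1 := fun v hv hvκ => by
    refine lt_of_le_of_lt ?_ hsmall
    rw [mul_assoc]
    refine mul_le_mul_of_nonneg_left ?_ hξ.le
    refine mul_le_mul (hmono (Real.le_sqrt_of_sq_le hvκ)) ?_ (abs_nonneg _)
      (hsnn _ (Real.sqrt_nonneg _))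
    rw [abs_of_nonpos (by linarith)]; nlinarith
  have hwκ : κ < w ^ 2 := by
    by_contra h
    exact absurd hc (hmid w hw0 (not_lt.mp h)).ne
  rw [abs_of_pos (sub_pos.mpr hwκ)] at hc
  have hout : ∀ v, w < v → 1 ≤ |ξ| * score f f' v * (v ^ 2 - κ) := fun v hv => by
    have h1 := hmono hv.le
    have h2 := hsnn w hw0
    rw [← hc]
    have h3 : w ^ 2 - κ ≤ v ^ 2 - κ := by nlinarith
    have h4 : 0 ≤ w ^ 2 - κ := by linarith
    have h5 : 0 ≤ |ξ| * score f f' v := mul_nonneg hξ.le (h2.trans h1)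
    gcongr
  have hfu := hf.pos u
  have hterm : -ξ * f' u * (u ^ 2 - κ) = ξ * score f f' u * (u ^ 2 - κ) * f u := by
    rw [hf' u]; ring
  have hterm2 : ξ * σ⁻¹ * f' u * (u ^ 2 - κ)
      = -(σ⁻¹ * (ξ * score f f' u * (u ^ 2 - κ) * f u)) := by
    rw [hf' u]; ring
  have e1 : (|x - θ| ≤ σ * w) ↔ |u| ≤ w := by
    rw [hxu, abs_mul, abs_of_pos hσ, mul_le_mul_iff_right₀ hσ]
  have e2 : (x - θ > σ * w) ↔ w < u := by
    rw [hxu, gt_iff_lt, mul_lt_mul_iff_right₀ hσ]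
  have e3 : (x - θ < -(σ * w)) ↔ u < -w := by
    rw [hxu, ← mul_neg, mul_lt_mul_iff_right₀ hσ]
  simp only [edgeworthDensity, ← hu, ← hκ, hterm, hterm2, e1, e2, e3]
  obtain ⟨c, hcdef⟩ : ∃ c, c = ξ * score f f' u * (u ^ 2 - κ) := ⟨_, rfl⟩
  simp only [← hcdef]
  have hup : 1 ≤ c → f u ≤ c * f u := fun h => le_mul_of_one_le_left hfu.le h
  have hlo : c ≤ -1 → c * f u ≤ -f u := fun h => by
    have := mul_le_mul_of_nonneg_right h hfu.le
    linarith
  rcases le_or_gt |u| w with h | h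
  · obtain ⟨h1, h2⟩ := abs_le.mp h
    rw [if_pos h, if_neg (not_lt.mpr h2), if_neg (not_lt.mpr h1)]
    have hc1 : |c| ≤ 1 := by
      rw [hcdef, abs_mul, abs_mul, hsabs, ← sq_abs u]
      rcases le_total (|u| ^ 2) κ with h3 | h3
      · exact (hmid _ (abs_nonneg u) h3).le
      · rw [abs_of_nonneg (by linarith : 0 ≤ |u| ^ 2 - κ), ← hc]
        have h4 := hmono h
        have h5 := hsnn _ (abs_nonneg u)
        have h6 : 0 ≤ |u| ^ 2 - κ := by linarith
        have h7 := hsnn w hw0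
        gcongr
    obtain ⟨h3, h4⟩ := abs_le.mp hc1
    have h5 := mul_le_mul_of_nonneg_right h3 hfu.le
    have h6 := mul_le_mul_of_nonneg_right h4 hfu.le
    rw [min_eq_right (by linarith), max_eq_right (by linarith)]
    ring
  · rw [if_neg (not_le.mpr h)]
    rcases lt_abs.mp h with h | h
    · rw [if_pos h, if_neg (by linarith)]
      have h1 := hout u h
      rcases lt_or_gt_of_ne (abs_pos.mp hξ) with h2 | h2
      · rw [abs_of_neg h2] at h1
        have h3 : c ≤ -1 := by rw [hcdef]; linarith
        rw [Real.sign_of_neg h2, min_eq_right (by linarith [hlo h3]), max_eq_left (hlo h3)]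
        ring
      · rw [abs_of_pos h2] at h1
        have h3 : 1 ≤ c := by rw [hcdef]; linarith
        rw [Real.sign_of_pos h2, min_eq_left (hup h3), max_eq_right (by linarith)]
        ring
    · rw [if_neg (by linarith), if_pos (by linarith)]
      have h1 := hout (-u) h
      rw [hs, neg_sq] at h1
      rcases lt_or_gt_of_ne (abs_pos.mp hξ) with h2 | h2
      · rw [abs_of_neg h2] at h1
        have h3 : 1 ≤ c := by rw [hcdef]; linarith
        rw [Real.sign_of_neg h2, min_eq_left (hup h3), max_eq_right (by linarith)]
        ring
      · rw [abs_of_pos h2] at h1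
        have h3 : c ≤ -1 := by rw [hcdef]; linarith
        rw [Real.sign_of_pos h2, min_eq_right (by linarith [hlo h3]), max_eq_left (hlo h3)]
        ring

/-- The law `P^{(n)}_{θ,σ,ξ;f}` of an i.i.d. `n`-sample with density `edgeworthDensity f f' θ σ ξ`. -/
def law (f f' : ℝ → ℝ) (θ σ ξ : ℝ) (n : ℕ) : Measure (Fin n → ℝ) :=
  Measure.pi fun _ => volume.withDensity fun x => ENNReal.ofReal (edgeworthDensity f f' θ σ ξ x)

/-! ### Test statistics -/

/-- The empirical moment `m_k(θ) = n⁻¹ ∑ (X_i - θ)^k`. -/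
def empMoment (k : ℕ) (θ : ℝ) {n : ℕ} (X : Fin n → ℝ) : ℝ := (∑ i, (X i - θ) ^ k) / n

/-- The classical statistic `S₁(θ) = n^{1/2} m₃(θ) / m₆(θ)^{1/2}`. -/
def statS (θ : ℝ) (n : ℕ) (X : Fin n → ℝ) : ℝ :=
  Real.sqrt n * empMoment 3 θ X / Real.sqrt (empMoment 6 θ X)

/-- The pseudo-Gaussian statistic
`T†(θ) = (n γ†)^{-1/2} ∑ (X_i - θ) ((X_i - θ)² - 3 m₂(θ))` with `γ† = m₆ - 6 m₂ m₄ + 9 m₂³`. -/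
def statT (θ : ℝ) (n : ℕ) (X : Fin n → ℝ) : ℝ :=
  (∑ i, (X i - θ) * ((X i - θ) ^ 2 - 3 * empMoment 2 θ X)) /
    Real.sqrt (n * (empMoment 6 θ X - 6 * empMoment 2 θ X * empMoment 4 θ X
      + 9 * empMoment 2 θ X ^ 3))

/-! ### Asymptotic notions -/

/-- The statistics `T n` are asymptotically normal with mean `m` and variance one under the
probability measures `P n`. -/
def IsAsympNormal (P : (n : ℕ) → Measure (Fin n → ℝ)) (T : (n : ℕ) → (Fin n → ℝ) → ℝ)
    (m : ℝ) : Prop :=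
  ∃ _ : ∀ n, IsProbabilityMeasure (P n),
    TendstoInDistribution T atTop (id : ℝ → ℝ) P (gaussianReal m 1)

/-- The nonrandomized test rejecting when `T n` exceeds `z`. -/
def rejectAbove (T : (n : ℕ) → (Fin n → ℝ) → ℝ) (z : ℝ) (n : ℕ) : (Fin n → ℝ) → ℝ :=
  Set.indicator {X | z < T n X} fun _ => 1

/-- A sequence of (possibly randomized) tests. -/
def IsTest (ψ : (n : ℕ) → (Fin n → ℝ) → ℝ) : Prop :=
  ∀ n, Measurable (ψ n) ∧ ∀ X, 0 ≤ ψ n X ∧ ψ n X ≤ 1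

/-- `ψ` has asymptotic level `α` for the null hypothesis of symmetry with respect to `θ`, with
unspecified scale and unspecified standardized density in `𝓕_{φ₁}`. -/
def HasAsympLevel (a θ α : ℝ) (ψ : (n : ℕ) → (Fin n → ℝ) → ℝ) : Prop :=
  ∀ g g' : ℝ → ℝ, IsRegularFor (gaussDensity a) (deriv (gaussDensity a)) g g' →
    ∀ σ > 0, ∀ ε > 0, ∀ᶠ n : ℕ in atTop, ∫ X, ψ n X ∂(law g g' θ σ 0 n) ≤ α + ε

/-- `ψ` is locally asymptotically most powerful at asymptotic level `α`, for the null hypothesis of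
symmetry with respect to `θ`, against the Gaussian Edgeworth alternatives with `ξ > 0`: no test of
asymptotic level `α` has asymptotically larger power along some `ξ = n^{-1/2} τ`, `τ > 0`. -/
def IsLocallyMostPowerful (a θ α : ℝ) (ψ : (n : ℕ) → (Fin n → ℝ) → ℝ) : Prop :=
  IsTest ψ ∧ HasAsympLevel a θ α ψ ∧
    ∀ χ : (n : ℕ) → (Fin n → ℝ) → ℝ, IsTest χ → HasAsympLevel a θ α χ →
      ∀ σ > 0, ∀ τ > 0, ∀ ε > 0, ∀ᶠ n : ℕ in atTop,
        ∫ X, χ n X ∂(law (gaussDensity a) (deriv (gaussDensity a)) θ σ (τ / Real.sqrt n) n) ≤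
          ∫ X, ψ n X ∂(law (gaussDensity a) (deriv (gaussDensity a)) θ σ (τ / Real.sqrt n) n) + ε

/-- `e` is the (Pitman) asymptotic relative efficiency of `T` with respect to `S` in the model
`(P ξ n)`, for testing `ξ = 0` against `ξ > 0` by tests that reject for large values. At every
asymptotic level `α` (with standard normal critical values) and along every sequence
`ξ = n^{-1/2} τ`, `τ > 0`, the limiting power of the test based on `T` and `n` observations
exists, is in `(α, 1)`, and is also that of the test based on `S` and `N n` observations, where
`N n / n` has a positive limit, if and only if this limit is `e`. -/
def IsARE (P : ℝ → (n : ℕ) → Measure (Fin n → ℝ)) (T S : (n : ℕ) → (Fin n → ℝ) → ℝ)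
    (e : ℝ) : Prop :=
  0 < e ∧ ∀ α z : ℝ, (gaussianReal 0 1).real (Set.Ioi z) = α →
    Tendsto (fun n => (P 0 n).real {X | z < T n X}) atTop (𝓝 α) ∧
    Tendsto (fun n => (P 0 n).real {X | z < S n X}) atTop (𝓝 α) ∧
    ∀ τ > 0, ∃ β, α < β ∧ β < 1 ∧
      Tendsto (fun n : ℕ => (P (τ / Real.sqrt n) n).real {X | z < T n X}) atTop (𝓝 β) ∧
      ∀ (N : ℕ → ℕ) (r : ℝ), 0 < r → Tendsto (fun n : ℕ => (N n : ℝ) / n) atTop (𝓝 r) →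
        (Tendsto (fun n : ℕ => (P (τ / Real.sqrt n) (N n)).real {X | z < S (N n) X})
          atTop (𝓝 β) ↔ r = e)

end

end Edgeworth

/-! Standardizing reduces everything to θ = 0 and σ = 1, both statistics being invariant. The law of
one observation then has density g plus a perturbation truncated to [-g, g]. This density is at most
2g, and it tends to g pointwise as ξ → 0. Neither contiguity nor a likelihood expansion is needed:
moments under g dominate, and characteristic functions of row sums are computed directly. If φ is
the characteristic function of one summand and N(φ - 1) → L, then φ^N → exp L
(`tendsto_pow_exp_of_mul_sub_one`); the limit L comes from Taylor expansion and dominated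
convergence. This yields a law of large numbers and a central limit theorem for arrays.

For an odd statistic w the symmetric part g contributes nothing to the mean, so with √N ξ → τ the
mean of N^{-1/2} ∑ w(X_i) tends to τ ∫ w (z² - κ)(-g') (`tendsto_sqrt_mul_integral`). Integration by
parts turns this into moments (`integral_cubic_deriv`). For w = z³ the shift is τ(5μ₄ - 3κμ₂) and
the variance μ₆. For w = z³ - 3μ₂z the shift loses a further 3τμ₂(3μ₂ - κ), and the variance is γ =
μ₆ - 6μ₂μ₄ + 9μ₂³. Slutsky's theorem replaces population moments by empirical ones.

At the Gaussian, μ₂ = 1/a, μ₄ = 3/a², μ₆ = 15/a³ and κ = 3/a. Hence 3μ₂ = κ and both statistics have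
the same unnormalized shift 6τ/a², but the variance is 15/a³ for S₁ and only 6/a³ for T†. The
normalized shifts are τ√(12/(5a)) and τ√(6/a). Since T† also has asymptotic level α on the whole
null class and power increases strictly with the shift, the S₁-test is not optimal. Using N ~ rn
observations multiplies the shift of S₁ by √r, so the powers agree exactly when r is the squared
ratio of shifts, 15/6 = 5/2. -/

namespace Edgeworth

/-! ### Convergence in probability along a sequence of probability spaces -/

/-- `D n` converges to the constant `c` in probability under `P n`. -/
def TendstoInProb {Ω : ℕ → Type*} [∀ n, MeasurableSpace (Ω n)] {E : Type*} [PseudoMetricSpace E]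
    (P : ∀ n, Measure (Ω n)) (D : ∀ n, Ω n → E) (c : E) : Prop :=
  ∀ ε > 0, Tendsto (fun n => (P n).real {ω | ε ≤ dist (D n ω) c}) atTop (𝓝 0)

/-- The sequence `A n` is bounded in probability under `P n`. -/
def BoundedInProb {Ω : ℕ → Type*} [∀ n, MeasurableSpace (Ω n)]
    (P : ∀ n, Measure (Ω n)) (A : ∀ n, Ω n → ℝ) : Prop :=
  ∀ δ > 0, ∃ M > 0, ∀ n, (P n).real {ω | M ≤ |A n ω|} ≤ δ

section InProb

variable {Ω : ℕ → Type*} [∀ n, MeasurableSpace (Ω n)] {P : ∀ n, Measure (Ω n)}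
  [∀ n, IsProbabilityMeasure (P n)]
  {E F : Type*} [PseudoMetricSpace E] [PseudoMetricSpace F]

theorem TendstoInProb.prodMk {D : ∀ n, Ω n → E} {D' : ∀ n, Ω n → F} {c : E} {c' : F}
    (h : TendstoInProb P D c) (h' : TendstoInProb P D' c') :
    TendstoInProb P (fun n ω => (D n ω, D' n ω)) (c, c') := by
  intro ε hε
  refine squeeze_zero (fun _ => measureReal_nonneg) (fun n => ?_)
    (by simpa using (h ε hε).add (h' ε hε))
  refine (measureReal_mono ?_).trans (measureReal_union_le _ _)
  intro ω hω
  simpa [Prod.dist_eq] using hω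

theorem TendstoInProb.comp_continuousAt {D : ∀ n, Ω n → E} {c : E} (h : TendstoInProb P D c)
    {f : E → F} (hf : ContinuousAt f c) : TendstoInProb P (fun n ω => f (D n ω)) (f c) := by
  intro ε hε
  obtain ⟨δ, hδ, hd⟩ := Metric.continuousAt_iff.1 hf ε hε
  refine squeeze_zero (fun _ => measureReal_nonneg) (fun n => ?_) (h δ hδ)
  refine measureReal_mono ?_
  intro ω hω
  by_contra hc
  simp only [Set.mem_ofPred_eq, not_le] at hc hω
  exact absurd (hd hc) (not_lt.2 hω)

/-- If the product is at least ε in absolute value, then either the bounded factor reaches M or the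
vanishing one reaches ε / M. -/
theorem BoundedInProb.mul_tendstoInProb {A D : ∀ n, Ω n → ℝ} (hA : BoundedInProb P A)
    (hD : TendstoInProb P D 0) : TendstoInProb P (fun n ω => A n ω * D n ω) 0 := by
  intro ε hε
  rw [Metric.tendsto_atTop]
  intro δ hδ
  obtain ⟨M, hM, hb⟩ := hA (δ / 2) (half_pos hδ)
  obtain ⟨k, hk⟩ := Metric.tendsto_atTop.1 (hD (ε / M) (div_pos hε hM)) (δ / 2) (half_pos hδ)
  refine ⟨k, fun n hn => ?_⟩
  have h1 := hk n hn
  rw [Real.dist_0_eq_abs, abs_of_nonneg measureReal_nonneg] at h1 ⊢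
  have hsub : {ω | ε ≤ dist (A n ω * D n ω) 0} ⊆
      {ω | M ≤ |A n ω|} ∪ {ω | ε / M ≤ dist (D n ω) 0} := by
    intro ω hω
    by_contra hc
    simp only [Set.mem_union, Set.mem_ofPred_eq, not_or, not_le, Real.dist_0_eq_abs] at hc hω
    rw [abs_mul] at hω
    have : |A n ω| * |D n ω| < M * (ε / M) :=
      mul_lt_mul'' hc.1 hc.2 (abs_nonneg _) (abs_nonneg _)
    rw [mul_div_cancel₀ _ hM.ne'] at this
    linarith
  calc (P n).real {ω | ε ≤ dist (A n ω * D n ω) 0}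
      ≤ _ := measureReal_mono hsub
    _ ≤ _ := measureReal_union_le _ _
    _ < δ := by linarith [hb n]

theorem TendstoInProb.add {A D : ∀ n, Ω n → ℝ} {c d : ℝ} (hA : TendstoInProb P A c)
    (hD : TendstoInProb P D d) : TendstoInProb P (fun n ω => A n ω + D n ω) (c + d) :=
  (hA.prodMk hD).comp_continuousAt (f := fun p : ℝ × ℝ => p.1 + p.2) (by fun_prop)

/-- Lévy's continuity theorem combined with the portmanteau theorem. -/
theorem tendsto_measureReal_preimage_of_charFun {S : ∀ n, Ω n → ℝ}
    (hS : ∀ n, AEMeasurable (S n) (P n)) {ν : Measure ℝ} [IsProbabilityMeasure ν]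
    (h : ∀ t : ℝ, Tendsto (fun n => charFun ((P n).map (S n)) t) atTop (𝓝 (charFun ν t)))
    {B : Set ℝ} (hB : MeasurableSet B) (hfr : ν (frontier B) = 0) :
    Tendsto (fun n => (P n).real (S n ⁻¹' B)) atTop (𝓝 (ν.real B)) := by
  let μs : ℕ → ProbabilityMeasure ℝ := fun n =>
    ⟨(P n).map (S n), Measure.isProbabilityMeasure_map (hS n)⟩
  let μ₀ : ProbabilityMeasure ℝ := ⟨ν, inferInstance⟩
  have hlim : Tendsto μs atTop (𝓝 μ₀) := ProbabilityMeasure.tendsto_iff_tendsto_charFun.2 h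
  have h2 := ProbabilityMeasure.tendsto_measure_of_null_frontier_of_tendsto' hlim (E := B) hfr
  have h3 := (ENNReal.tendsto_toReal (measure_ne_top ν B)).comp h2
  refine h3.congr fun n => ?_
  change ((P n).map (S n) B).toReal = _
  rw [Measure.map_apply_of_aemeasurable (hS n) hB]
  rfl

/-- Convergence in law to a constant is convergence in probability: the closed set of points at
distance at least ε from c contains its frontier and is null for the Dirac mass at c. -/
theorem tendstoInProb_of_charFun {D : ∀ n, Ω n → ℝ} (hD : ∀ n, AEMeasurable (D n) (P n)) {c : ℝ}
    (h : ∀ t : ℝ, Tendsto (fun n => charFun ((P n).map (D n)) t) atTop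
      (𝓝 (Complex.exp (t * c * Complex.I)))) : TendstoInProb P D c := by
  intro ε hε
  have hcl : IsClosed {x : ℝ | ε ≤ dist x c} := isClosed_le continuous_const (by fun_prop)
  have hnull : Measure.dirac c {x : ℝ | ε ≤ dist x c} = 0 := by
    rw [Measure.dirac_apply' _ hcl.measurableSet]
    simp [hε]
  have h2 := tendsto_measureReal_preimage_of_charFun hD (ν := Measure.dirac c)
    (fun t => by simpa [charFun_dirac, mul_comm] using h t) hcl.measurableSet
    (measure_mono_null hcl.frontier_subset hnull)
  rw [Measure.real, hnull] at h2
  exact h2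

/-- The limit of the characteristic functions is continuous at 0, so the laws form a tight family; a
compact set carrying most of each mass lies in a ball, uniformly in n. -/
theorem boundedInProb_of_charFun {A : ∀ n, Ω n → ℝ} (hA : ∀ n, AEMeasurable (A n) (P n))
    {ν : Measure ℝ} [IsProbabilityMeasure ν]
    (h : ∀ t : ℝ, Tendsto (fun n => charFun ((P n).map (A n)) t) atTop (𝓝 (charFun ν t))) :
    BoundedInProb P A := by
  intro δ hδ
  have := fun n => Measure.isProbabilityMeasure_map (hA n)
  have ht := isTightMeasureSet_of_tendsto_charFun (μ := fun n => (P n).map (A n))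
    (f := charFun ν) continuous_charFun.continuousAt h
  obtain ⟨K, hK, hle⟩ := isTightMeasureSet_iff_exists_isCompact_measure_compl_le.1 ht
    (ENNReal.ofReal δ) (by simpa using hδ)
  obtain ⟨R, hR⟩ := hK.isBounded.subset_closedBall 0
  refine ⟨max R 0 + 1, by positivity, fun n => ?_⟩
  have h1 : {ω | max R 0 + 1 ≤ |A n ω|} ⊆ A n ⁻¹' Kᶜ := by
    intro ω hω hc
    have := hR hc
    rw [Metric.mem_closedBall, Real.dist_0_eq_abs] at this
    have h2 : max R 0 + 1 ≤ |A n ω| := hω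
    linarith [le_max_left R 0]
  refine (measureReal_mono h1).trans ?_
  refine ENNReal.toReal_le_of_le_ofReal hδ.le ?_
  rw [← Measure.map_apply_of_aemeasurable (hA n) hK.isClosed.measurableSet.compl]
  exact hle _ ⟨n, rfl⟩

/-- Slutsky's theorem, in terms of characteristic functions. -/
theorem tendsto_charFun_of_tendstoInProb_sub {A S : ∀ n, Ω n → ℝ}
    (hA : ∀ n, Measurable (A n)) (hS : ∀ n, Measurable (S n)) {t : ℝ} {L : ℂ}
    (h : Tendsto (fun n => charFun ((P n).map (A n)) t) atTop (𝓝 L))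
    (hd : TendstoInProb P (fun n ω => S n ω - A n ω) 0) :
    Tendsto (fun n => charFun ((P n).map (S n)) t) atTop (𝓝 L) := by
  -- Where S and A differ by less than ε the integrands differ by at most |t| ε; elsewhere by at
  -- most 2, both having modulus one.
  have key : ∀ ε > 0, ∀ n, ‖charFun ((P n).map (S n)) t - charFun ((P n).map (A n)) t‖ ≤
      |t| * ε + 2 * (P n).real {ω | ε ≤ dist (S n ω - A n ω) 0} := by
    intro ε hε n
    have hexp : ∀ x : ℝ, ‖Complex.exp (t * x * Complex.I)‖ = 1 := fun x => by
      rw [← Complex.ofReal_mul, Complex.norm_exp_ofReal_mul_I]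
    have hint : ∀ B : Ω n → ℝ, Measurable B →
        Integrable (fun ω => Complex.exp (t * B ω * Complex.I)) (P n) := fun B hB =>
      Integrable.of_bound (by fun_prop) 1 (ae_of_all _ fun ω => (hexp _).le)
    have hms : MeasurableSet {ω | ε ≤ dist (S n ω - A n ω) 0} :=
      measurableSet_le measurable_const (((hS n).sub (hA n)).dist measurable_const)
    rw [charFun_apply_real, charFun_apply_real, integral_map (hS n).aemeasurable (by fun_prop),
      integral_map (hA n).aemeasurable (by fun_prop), ← integral_sub (hint _ (hS n)) (hint _ (hA n))]
    have hb : ∀ ω, ‖Complex.exp (t * S n ω * Complex.I) - Complex.exp (t * A n ω * Complex.I)‖ ≤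
        |t| * ε + 2 * Set.indicator {ω | ε ≤ dist (S n ω - A n ω) 0} (fun _ => (1 : ℝ)) ω := by
      intro ω
      by_cases hω : ω ∈ {ω | ε ≤ dist (S n ω - A n ω) 0}
      · rw [Set.indicator_of_mem hω]
        refine (norm_sub_le _ _).trans ?_
        rw [hexp, hexp]
        have : 0 ≤ |t| * ε := by positivity
        linarith
      · rw [Set.indicator_of_notMem hω]
        have e : Complex.exp (t * S n ω * Complex.I) - Complex.exp (t * A n ω * Complex.I) =
            Complex.exp (t * A n ω * Complex.I) *
              (Complex.exp (Complex.I * ((t * (S n ω - A n ω) : ℝ) : ℂ)) - 1) := by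
          rw [mul_sub, mul_one, ← Complex.exp_add]
          congr 2
          push_cast; ring
        rw [e, norm_mul, hexp, one_mul]
        refine Real.norm_exp_I_mul_ofReal_sub_one_le.trans ?_
        rw [Real.norm_eq_abs, abs_mul]
        simp only [Set.mem_ofPred_eq, not_le, Real.dist_0_eq_abs] at hω
        have := mul_le_mul_of_nonneg_left hω.le (abs_nonneg t)
        linarith
    refine (norm_integral_le_of_norm_le (g := fun ω => |t| * ε + 2 *
      Set.indicator {ω | ε ≤ dist (S n ω - A n ω) 0} (fun _ => (1 : ℝ)) ω) ?_
      (ae_of_all _ hb)).trans ?_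
    · exact (integrable_const _).add (((integrable_const _).indicator hms).const_mul _)
    · rw [integral_add (integrable_const _) (((integrable_const _).indicator hms).const_mul _),
        integral_const_mul 2, integral_indicator_const _ hms]
      simp
  have hz : Tendsto (fun n => charFun ((P n).map (S n)) t - charFun ((P n).map (A n)) t) atTop
      (𝓝 0) := by
    rw [tendsto_zero_iff_norm_tendsto_zero, Metric.tendsto_atTop]
    intro δ hδ
    have hε : 0 < δ / (2 * (|t| + 1)) := by positivity
    obtain ⟨k, hk⟩ := Metric.tendsto_atTop.1 (hd _ hε) (δ / 4) (by positivity)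
    refine ⟨k, fun n hn => ?_⟩
    have h1 := hk n hn
    rw [Real.dist_0_eq_abs, abs_of_nonneg measureReal_nonneg] at h1
    rw [Real.dist_0_eq_abs, abs_norm]
    have h2 := key _ hε n
    have h3 : |t| * (δ / (2 * (|t| + 1))) ≤ δ / 2 := by
      rw [← mul_div_assoc, div_le_div_iff₀ (by positivity) (by positivity)]
      nlinarith [abs_nonneg t]
    linarith
  simpa using hz.add h

/-- Convergence of characteristic functions to that of a measure without atoms entails convergence
of upper tail probabilities. -/
theorem tendsto_measureReal_gt_of_charFun {S : ∀ n, Ω n → ℝ} (hS : ∀ n, Measurable (S n))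
    {ν : Measure ℝ} [IsProbabilityMeasure ν] [NullSingletonClass ν]
    (h : ∀ t : ℝ, Tendsto (fun n => charFun ((P n).map (S n)) t) atTop (𝓝 (charFun ν t)))
    (z : ℝ) : Tendsto (fun n => (P n).real {ω | z < S n ω}) atTop (𝓝 (ν.real (Set.Ioi z))) := by
  exact tendsto_measureReal_preimage_of_charFun (fun n => (hS n).aemeasurable) h
    (B := Set.Ioi z) measurableSet_Ioi (by rw [frontier_Ioi]; simp)

end InProb

/-! ### Characteristic functions of row sums -/

/-- The hypothesis forces φ → 1, where log φ = (φ - 1) + O(|φ - 1|²). After multiplication by N the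
error is |N(φ - 1)| |φ - 1| → 0, so N log φ → L. -/
theorem tendsto_pow_exp_of_mul_sub_one {N : ℕ → ℕ} (hN : Tendsto N atTop atTop) {φ : ℕ → ℂ} {L : ℂ}
    (h : Tendsto (fun n => (N n : ℂ) * (φ n - 1)) atTop (𝓝 L)) :
    Tendsto (fun n => φ n ^ N n) atTop (𝓝 (Complex.exp L)) := by
  have hNC : Tendsto (fun n => ((N n : ℂ))⁻¹) atTop (𝓝 0) :=
    (tendsto_inv_atTop_nhds_zero_nat (𝕜 := ℂ)).comp hN
  have hne : ∀ᶠ n in atTop, (N n : ℂ) ≠ 0 := by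
    filter_upwards [hN.eventually_ge_atTop 1] with n hn
    exact_mod_cast (by omega : N n ≠ 0)
  have hz : Tendsto (fun n => φ n - 1) atTop (𝓝 0) := by
    have := hNC.mul h
    rw [zero_mul] at this
    refine this.congr' ?_
    filter_upwards [hne] with n hn
    field_simp
  -- The radius 1/2 bounds the factor (1 - ‖φ - 1‖)⁻¹ by 2 in the logarithm estimate and keeps φ
  -- away from 0.
  have hsmall : ∀ᶠ n in atTop, ‖φ n - 1‖ < 1 / 2 := by
    have := hz.norm
    rw [norm_zero] at this
    exact this.eventually_lt_const (by norm_num)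
  have hlog : Tendsto (fun n => (N n : ℂ) * Complex.log (φ n)) atTop (𝓝 L) := by
    have hd : Tendsto (fun n => (N n : ℂ) * (Complex.log (φ n) - (φ n - 1))) atTop (𝓝 0) := by
      have hb : Tendsto (fun n => ‖(N n : ℂ) * (φ n - 1)‖ * ‖φ n - 1‖) atTop (𝓝 0) := by
        simpa using h.norm.mul hz.norm
      refine squeeze_zero_norm' ?_ hb
      filter_upwards [hsmall] with n hn
      have h1 := Complex.norm_log_one_add_sub_self_le (z := φ n - 1) (by linarith)
      rw [add_sub_cancel] at h1
      have h2 : (1 - ‖φ n - 1‖)⁻¹ ≤ 2 := by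
        rw [inv_le_comm₀ (by linarith) (by norm_num)]; linarith
      have h3 : ‖φ n - 1‖ ^ 2 * (1 - ‖φ n - 1‖)⁻¹ / 2 ≤ ‖φ n - 1‖ ^ 2 := by
        nlinarith [mul_le_mul_of_nonneg_left h2 (sq_nonneg ‖φ n - 1‖)]
      rw [norm_mul, norm_mul, mul_assoc, ← sq]
      exact mul_le_mul_of_nonneg_left (h1.trans h3) (norm_nonneg _)
    have := hd.add h
    rw [zero_add] at this
    refine this.congr fun n => ?_
    ring
  refine ((Complex.continuous_exp.tendsto _).comp hlog).congr' ?_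
  filter_upwards [hsmall] with n hn
  have h0 : φ n ≠ 0 := by
    intro h0
    rw [h0] at hn
    norm_num at hn
  simp only [Function.comp]
  rw [Complex.exp_nat_mul, Complex.exp_log h0]

theorem charFun_map_pi_sum {ν : Measure ℝ} [IsProbabilityMeasure ν] {w : ℝ → ℝ}
    (hw : Measurable w) (c t : ℝ) (n : ℕ) :
    charFun ((Measure.pi fun _ : Fin n => ν).map fun X => c * ∑ i, w (X i)) t =
      (∫ x, Complex.exp (((t * c * w x : ℝ) : ℂ) * Complex.I) ∂ν) ^ n := by
  have h := integral_fintype_prod_eq_pow (𝕜 := ℂ) (ι := Fin n) (μ := ν)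
    (fun x => Complex.exp (((t * c * w x : ℝ) : ℂ) * Complex.I))
  rw [Fintype.card_fin] at h
  have hm : Measurable fun X : Fin n → ℝ => c * ∑ i, w (X i) := by fun_prop
  rw [charFun_apply_real, integral_map hm.aemeasurable (by fun_prop), ← h]
  congr 1
  ext X
  rw [← Complex.exp_sum]
  congr 1
  push_cast
  rw [← Finset.sum_mul, ← Finset.mul_sum]
  ring

/-- A bound valid for all y, so that a second moment alone suffices for domination in the central
limit theorem. It is Taylor's estimate for |y| ≤ 1, and 1 + 1 + |y| ≤ 3y² beyond. -/
theorem norm_exp_mul_I_sub_one_sub_le (y : ℝ) :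
    ‖Complex.exp (y * Complex.I) - 1 - y * Complex.I‖ ≤ 3 * y ^ 2 := by
  rcases le_or_gt |y| 1 with h | h
  · have h1 := Complex.norm_exp_sub_one_sub_id_le (x := y * Complex.I) (by simpa using h)
    simp only [norm_mul, Complex.norm_real, Complex.norm_I, mul_one, Real.norm_eq_abs, sq_abs] at h1
    nlinarith [sq_nonneg y]
  · refine (norm_sub_le _ _).trans ?_
    refine (add_le_add_left (norm_sub_le _ _) _).trans ?_
    rw [Complex.norm_exp_ofReal_mul_I]
    simp only [norm_mul, Complex.norm_real, Complex.norm_I, mul_one, Real.norm_eq_abs, norm_one]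
    have : y ^ 2 = |y| * |y| := by rw [← sq, sq_abs]
    nlinarith

/-- `r² (exp (i y / r) - 1 - i y / r) → - y² / 2` as `r → ∞`. -/
theorem tendsto_sq_mul_exp_sub {r : ℕ → ℝ} (hr : Tendsto r atTop atTop) (y : ℝ) :
    Tendsto (fun n => ((r n ^ 2 : ℝ) : ℂ) * (Complex.exp (((y / r n : ℝ) : ℂ) * Complex.I) - 1
      - ((y / r n : ℝ) : ℂ) * Complex.I)) atTop (𝓝 (-(y : ℂ) ^ 2 / 2)) := by
  rw [tendsto_iff_norm_sub_tendsto_zero]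
  have hb : Tendsto (fun n => |y| ^ 3 * (r n)⁻¹) atTop (𝓝 0) := by
    simpa using (tendsto_inv_atTop_zero.comp hr).const_mul (|y| ^ 3)
  refine squeeze_zero' (Eventually.of_forall fun _ => norm_nonneg _) ?_ hb
  filter_upwards [hr.eventually_gt_atTop |y|, hr.eventually_gt_atTop 0] with n hn h0
  have hx : ‖((y / r n : ℝ) : ℂ) * Complex.I‖ ≤ 1 := by
    rw [norm_mul, Complex.norm_I, mul_one, Complex.norm_real, Real.norm_eq_abs, abs_div,
      abs_of_pos h0, div_le_one h0]
    exact hn.le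
  -- The third-order remainder is at most (2/9) |y / r|³, so it vanishes even after multiplication
  -- by r².
  have h1 := Complex.exp_bound hx (n := 3) (by norm_num)
  have e : ((r n ^ 2 : ℝ) : ℂ) * (Complex.exp (((y / r n : ℝ) : ℂ) * Complex.I) - 1
      - ((y / r n : ℝ) : ℂ) * Complex.I) - -(y : ℂ) ^ 2 / 2 =
      ((r n ^ 2 : ℝ) : ℂ) * (Complex.exp (((y / r n : ℝ) : ℂ) * Complex.I) -
        ∑ m ∈ Finset.range 3, (((y / r n : ℝ) : ℂ) * Complex.I) ^ m / (m.factorial : ℂ)) := by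
    simp only [Finset.sum_range_succ, Finset.sum_range_zero, Nat.factorial, mul_pow, Complex.I_sq]
    have : (r n : ℂ) ≠ 0 := by exact_mod_cast h0.ne'
    push_cast
    field_simp
    ring
  rw [e, norm_mul, Complex.norm_real, Real.norm_eq_abs, abs_of_nonneg (sq_nonneg _)]
  refine (mul_le_mul_of_nonneg_left h1 (sq_nonneg _)).trans ?_
  rw [norm_mul, Complex.norm_I, mul_one, Complex.norm_real, Real.norm_eq_abs, abs_div,
      abs_of_pos h0]
  have e2 : r n ^ 2 * ((|y| / r n) ^ 3 * (((3 : ℕ).succ : ℝ) * (((3 : ℕ).factorial : ℝ) * (3 : ℕ))⁻¹))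
      = (2 / 9) * (|y| ^ 3 * (r n)⁻¹) := by
    simp only [Nat.factorial]
    push_cast
    field_simp
    ring
  rw [e2]
  have : 0 ≤ |y| ^ 3 * (r n)⁻¹ := by positivity
  linarith

/-- `r (exp (i y / r) - 1) → i y` as `r → ∞`. -/
theorem tendsto_mul_exp_sub_one {r : ℕ → ℝ} (hr : Tendsto r atTop atTop) (y : ℝ) :
    Tendsto (fun n => ((r n : ℝ) : ℂ) * (Complex.exp (((y / r n : ℝ) : ℂ) * Complex.I) - 1)) atTop
      (𝓝 (y * Complex.I)) := by
  -- Dividing the second-order limit by r leaves r (exp (i y / r) - 1) - i y → 0.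
  have h := (tendsto_sq_mul_exp_sub hr y).mul
    (Complex.continuous_ofReal.continuousAt.tendsto.comp (tendsto_inv_atTop_zero.comp hr))
  have h2 := h.add_const ((y : ℂ) * Complex.I)
  simp only [Complex.ofReal_zero, mul_zero, zero_add] at h2
  refine h2.congr' ?_
  filter_upwards [hr.eventually_gt_atTop 0] with n h0
  have : (r n : ℂ) ≠ 0 := by exact_mod_cast h0.ne'
  simp only [Function.comp]
  push_cast
  field_simp
  ring

/-! ### Arrays with dominated densities -/

/-- The measure with Lebesgue density `q`. -/
noncomputable def densityMeasure (q : ℝ → ℝ) : Measure ℝ :=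
  volume.withDensity fun x => ENNReal.ofReal (q x)

/-- A sequence of probability densities `q n`, dominated by `2 g` and convergent to `g`. -/
structure DominatedDensities (g : ℝ → ℝ) (q : ℕ → ℝ → ℝ) : Prop where
  integrable : Integrable g
  measurable : ∀ n, Measurable (q n)
  nonneg : ∀ n x, 0 ≤ q n x
  le : ∀ n x, q n x ≤ 2 * g x
  tendsto : ∀ x, Tendsto (fun n => q n x) atTop (𝓝 (g x))
  integral_eq_one : ∀ n, ∫ x, q n x = 1

theorem integral_densityMeasure {q : ℝ → ℝ} (hm : Measurable q) (h0 : ∀ x, 0 ≤ q x)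
    {E : Type*} [NormedAddCommGroup E] [NormedSpace ℝ E] (F : ℝ → E) :
    ∫ x, F x ∂(densityMeasure q) = ∫ x, q x • F x := by
  rw [densityMeasure, integral_withDensity_eq_integral_toReal_smul (by fun_prop) (by simp)]
  simp only [ENNReal.toReal_ofReal (h0 _)]

/-! ### Limit theorems for arrays with dominated densities. -/

namespace DominatedDensities

variable {g : ℝ → ℝ} {q : ℕ → ℝ → ℝ}

theorem integrable_density (h : DominatedDensities g q) (n : ℕ) : Integrable (q n) := by
  refine (h.integrable.const_mul 2).mono' (h.measurable n).aestronglyMeasurable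
    (ae_of_all _ fun x => ?_)
  rw [Real.norm_eq_abs, abs_of_nonneg (h.nonneg n x)]
  exact h.le n x

theorem isProbabilityMeasure (h : DominatedDensities g q) (n : ℕ) :
    IsProbabilityMeasure (densityMeasure (q n)) := by
  constructor
  rw [densityMeasure, withDensity_apply _ MeasurableSet.univ, Measure.restrict_univ,
    ← ofReal_integral_eq_lintegral_ofReal (h.integrable_density n) (ae_of_all _ (h.nonneg n)),
    h.integral_eq_one, ENNReal.ofReal_one]

/-- Dominated convergence in which the measure moves too: after transfer to Lebesgue measure the
integrands are bounded by 2 K g. -/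
theorem tendsto_integral (h : DominatedDensities g q) {F : ℕ → ℝ → ℂ} {F₀ : ℝ → ℂ} {K : ℝ → ℝ}
    (hF : ∀ n, Measurable (F n)) (hK : Integrable fun x => K x * g x)
    (hle : ∀ n x, ‖F n x‖ ≤ K x) (hlim : ∀ x, Tendsto (fun n => F n x) atTop (𝓝 (F₀ x))) :
    Tendsto (fun n => ∫ x, F n x ∂(densityMeasure (q n))) atTop (𝓝 (∫ x, g x • F₀ x)) := by
  have e : ∀ n, ∫ x, F n x ∂(densityMeasure (q n)) = ∫ x, q n x • F n x := fun n =>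
    integral_densityMeasure (h.measurable n) (h.nonneg n) _
  simp only [e]
  refine tendsto_integral_of_dominated_convergence (fun x => 2 * (K x * g x))
    (fun n => ((h.measurable n).smul (hF n)).aestronglyMeasurable) (hK.const_mul 2)
    (fun n => ae_of_all _ fun x => ?_) (ae_of_all _ fun x => (h.tendsto x).smul (hlim x))
  rw [norm_smul, Real.norm_eq_abs, abs_of_nonneg (h.nonneg n x)]
  have h1 := h.le n x
  have h2 := hle n x
  have h3 := h.nonneg n x
  calc q n x * ‖F n x‖ ≤ (2 * g x) * K x :=
        mul_le_mul h1 h2 (norm_nonneg _) (h3.trans h1)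
    _ = _ := by ring

theorem integrable_densityMeasure (h : DominatedDensities g q) {w : ℝ → ℝ} (hw : Measurable w)
    (hi : Integrable fun x => w x * g x) (n : ℕ) : Integrable w (densityMeasure (q n)) := by
  rw [densityMeasure, integrable_withDensity_iff (by have := h.measurable n; fun_prop) (by simp)]
  refine (hi.norm.const_mul 2).mono' (hw.mul (by have := h.measurable n; fun_prop)).aestronglyMeasurable
    (ae_of_all _ fun x => ?_)
  have h1 := h.le n x
  have h3 := h.nonneg n x
  rw [ENNReal.toReal_ofReal h3]
  simp only [norm_mul, Real.norm_eq_abs]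
  rw [abs_of_nonneg h3, abs_of_nonneg (by linarith : 0 ≤ g x)]
  nlinarith [abs_nonneg (w x)]

/-- Weak law of large numbers for row sums. -/
theorem tendsto_charFun_mean (h : DominatedDensities g q) {N : ℕ → ℕ} (hN : Tendsto N atTop atTop)
    {w : ℝ → ℝ} (hw : Measurable w) (hi : Integrable fun x => w x * g x) (t : ℝ) :
    Tendsto (fun n => charFun ((Measure.pi fun _ : Fin (N n) => densityMeasure (q n)).map
        fun X => (N n : ℝ)⁻¹ * ∑ i, w (X i)) t) atTop
      (𝓝 (Complex.exp (t * (∫ x, w x * g x : ℝ) * Complex.I))) := by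
  have := h.isProbabilityMeasure
  simp only [charFun_map_pi_sum hw]
  refine tendsto_pow_exp_of_mul_sub_one hN ?_
  have hr : Tendsto (fun n => (N n : ℝ)) atTop atTop := tendsto_natCast_atTop_atTop.comp hN
  -- N (exp (i t w / N) - 1) tends to i t w and is bounded by |t w|.
  have key := h.tendsto_integral (K := fun x => ‖t * w x‖)
    (F := fun n x => ((N n : ℝ) : ℂ) *
      (Complex.exp (((t * w x / N n : ℝ) : ℂ) * Complex.I) - 1))
    (F₀ := fun x => ((t * w x : ℝ) : ℂ) * Complex.I) (fun n => by fun_prop) ?_ ?_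
    (fun x => tendsto_mul_exp_sub_one hr _)
  · have e1 : ∫ x, g x • (((t * w x : ℝ) : ℂ) * Complex.I) =
        t * (∫ x, w x * g x : ℝ) * Complex.I := by
      have : ∀ x, g x • (((t * w x : ℝ) : ℂ) * Complex.I) =
          ((t : ℂ) * Complex.I) * ((w x * g x : ℝ) : ℂ) := fun x => by
        rw [Complex.real_smul]; push_cast; ring
      simp only [this]
      rw [integral_const_mul, integral_complex_ofReal]
      ring
    rw [e1] at key
    refine key.congr fun n => ?_
    rw [integral_const_mul, integral_sub (Integrable.of_bound (by fun_prop) 1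
      (ae_of_all _ fun x => (Complex.norm_exp_ofReal_mul_I _).le)) (integrable_const _)]
    simp [div_eq_mul_inv, mul_assoc, mul_comm, mul_left_comm]
  · have := (hi.norm.const_mul |t|)
    refine this.congr (ae_of_all _ fun x => ?_)
    have : 0 ≤ g x := by have := h.nonneg 0 x; have := h.le 0 x; linarith
    simp only [norm_mul, Real.norm_eq_abs, abs_of_nonneg this]
    ring
  · intro n x
    -- The domination is required for every n; for an empty row the prefactor N vanishes.
    rcases Nat.eq_zero_or_pos (N n) with h0 | h0
    · simp only [h0, Nat.cast_zero, Complex.ofReal_zero, zero_mul, norm_zero]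
      positivity
    · have h0' : (0 : ℝ) < N n := by exact_mod_cast h0
      rw [norm_mul, Complex.norm_real, Real.norm_eq_abs, abs_of_pos h0', mul_comm _ Complex.I]
      refine (mul_le_mul_of_nonneg_left Real.norm_exp_I_mul_ofReal_sub_one_le h0'.le).trans ?_
      rw [norm_div, Real.norm_eq_abs (N n : ℝ), abs_of_pos h0', mul_div_cancel₀ _ h0'.ne']

/-- Central limit theorem for row sums. -/
theorem tendsto_charFun_sum (h : DominatedDensities g q) {N : ℕ → ℕ} (hN : Tendsto N atTop atTop)
    {w : ℝ → ℝ} (hw : Measurable w) (hi : Integrable fun x => w x * g x)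
    (hi2 : Integrable fun x => w x ^ 2 * g x) {m : ℝ}
    (hm : Tendsto (fun n => Real.sqrt (N n) * ∫ x, w x ∂(densityMeasure (q n))) atTop (𝓝 m))
    (t : ℝ) :
    Tendsto (fun n => charFun ((Measure.pi fun _ : Fin (N n) => densityMeasure (q n)).map
        fun X => (Real.sqrt (N n))⁻¹ * ∑ i, w (X i)) t) atTop
      (𝓝 (Complex.exp (t * m * Complex.I - (∫ x, w x ^ 2 * g x : ℝ) * t ^ 2 / 2))) := by
  have := h.isProbabilityMeasure
  simp only [charFun_map_pi_sum hw]
  refine tendsto_pow_exp_of_mul_sub_one hN ?_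
  have hr : Tendsto (fun n => Real.sqrt (N n)) atTop atTop :=
    Real.tendsto_sqrt_atTop.comp (tendsto_natCast_atTop_atTop.comp hN)
  -- Only the part beyond first order is treated by domination; the linear term, multiplied by √N,
  -- has its limit from `hm` and is added back below.
  have key := h.tendsto_integral (K := fun x => 3 * (t * w x) ^ 2)
    (F := fun n x => ((Real.sqrt (N n) ^ 2 : ℝ) : ℂ) *
      (Complex.exp (((t * w x / Real.sqrt (N n) : ℝ) : ℂ) * Complex.I) - 1 -
        ((t * w x / Real.sqrt (N n) : ℝ) : ℂ) * Complex.I))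
    (F₀ := fun x => -((t * w x : ℝ) : ℂ) ^ 2 / 2) (fun n => by fun_prop) ?_ ?_
    (fun x => tendsto_sq_mul_exp_sub hr _)
  · have e1 : ∫ x, g x • ((-((t * w x : ℝ) : ℂ) ^ 2 / 2 : ℂ)) =
        -((∫ x, w x ^ 2 * g x : ℝ) * t ^ 2 / 2) := by
      have : ∀ x, g x • (-((t * w x : ℝ) : ℂ) ^ 2 / 2 : ℂ) =
          (-(t : ℂ) ^ 2 / 2) * ((w x ^ 2 * g x : ℝ) : ℂ) := fun x => by
        rw [Complex.real_smul]; push_cast; ring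
      simp only [this]
      rw [integral_const_mul, integral_complex_ofReal]
      ring
    rw [e1] at key
    have key2 := ((Complex.continuous_ofReal.tendsto _).comp hm).const_mul ((t : ℂ) * Complex.I)
    have key3 := key2.add key
    have e2 : (t : ℂ) * Complex.I * (m : ℂ) + -((∫ x, w x ^ 2 * g x : ℝ) * (t : ℂ) ^ 2 / 2) =
        t * m * Complex.I - (∫ x, w x ^ 2 * g x : ℝ) * t ^ 2 / 2 := by ring
    rw [e2] at key3
    refine key3.congr' ?_
    filter_upwards [hr.eventually_gt_atTop 0] with n h0
    have hne : ((Real.sqrt (N n) : ℝ) : ℂ) ≠ 0 := by exact_mod_cast h0.ne'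
    have hsq : ((N n : ℕ) : ℂ) = ((Real.sqrt (N n) : ℝ) : ℂ) ^ 2 := by
      rw [← Complex.ofReal_pow, Real.sq_sqrt (Nat.cast_nonneg _)]
      simp
    have hexp : Integrable (fun x => Complex.exp (((t * w x / Real.sqrt (N n) : ℝ) : ℂ) *
        Complex.I)) (densityMeasure (q n)) := Integrable.of_bound (by fun_prop) 1
      (ae_of_all _ fun x => (Complex.norm_exp_ofReal_mul_I _).le)
    have hexp1 : Integrable (fun x => Complex.exp (((t * w x / Real.sqrt (N n) : ℝ) : ℂ) *
        Complex.I) - 1) (densityMeasure (q n)) := hexp.sub (integrable_const _)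
    have hlin : Integrable (fun x => ((t * w x / Real.sqrt (N n) : ℝ) : ℂ) * Complex.I)
        (densityMeasure (q n)) :=
      (((h.integrable_densityMeasure hw hi n).const_mul t).div_const _).ofReal.mul_const _
    rw [integral_const_mul, integral_sub hexp1 hlin,
      integral_sub hexp (integrable_const _)]
    have e3 : ∫ x, ((t * w x / Real.sqrt (N n) : ℝ) : ℂ) * Complex.I ∂(densityMeasure (q n)) =
        ((t / Real.sqrt (N n) : ℝ) : ℂ) * ((∫ x, w x ∂(densityMeasure (q n)) : ℝ) : ℂ)
          * Complex.I := by
      rw [integral_mul_const, integral_complex_ofReal]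
      congr 1
      rw [← Complex.ofReal_mul, ← integral_const_mul]
      congr 2
      ext x
      ring
    have e4 : ∀ x, t * (Real.sqrt (N n))⁻¹ * w x = t * w x / Real.sqrt (N n) := fun x => by
      field_simp
    simp only [e3, e4, hsq, integral_const, probReal_univ, one_smul, Function.comp]
    push_cast
    field_simp
    ring
  · have := (hi2.const_mul (3 * t ^ 2))
    refine this.congr (ae_of_all _ fun x => ?_)
    ring
  · intro n x
    rcases Nat.eq_zero_or_pos (N n) with h0 | h0
    · simp only [h0, Nat.cast_zero, Real.sqrt_zero]
      norm_num
      positivity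
    · have h0' : (0 : ℝ) < Real.sqrt (N n) := Real.sqrt_pos.2 (by exact_mod_cast h0)
      rw [norm_mul, Complex.norm_real, Real.norm_eq_abs, abs_of_pos (by positivity)]
      refine (mul_le_mul_of_nonneg_left (norm_exp_mul_I_sub_one_sub_le _) (by positivity)).trans ?_
      apply le_of_eq
      field_simp

end DominatedDensities

end Edgeworth

namespace Edgeworth

/-! ### Absolutely continuous symmetric densities with sixth moments -/

/-- Symmetric absolutely continuous densities with monotone score, finite information for asymmetry
and a finite sixth moment. -/
structure HasSixthMoment (g g' : ℝ → ℝ) : Prop where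
  pos : ∀ z, 0 < g z
  integrable : Integrable g
  integral_eq_one : ∫ z, g z = 1
  symm : ∀ z, g (-z) = g z
  abs_cont : ∀ z₁ z₂, IntervalIntegrable g' volume z₁ z₂ ∧ g z₂ - g z₁ = ∫ z in z₁..z₂, g' z
  monotone_score : Monotone (score g g')
  finite_info : Integrable fun z => z ^ 4 * score g g' z ^ 2 * g z
  sixth : Integrable fun z => z ^ 6 * g z

namespace HasSixthMoment

variable {g g' : ℝ → ℝ}

theorem deriv_eq (h : HasSixthMoment g g') (z : ℝ) : g' z = -(score g g' z * g z) := by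
  have := (h.pos z).ne'
  simp only [score]; field_simp

theorem continuous (h : HasSixthMoment g g') : Continuous g := by
  have h1 := intervalIntegral.continuous_primitive (fun a b => (h.abs_cont a b).1) 0
  have h2 : g = fun z => g 0 + ∫ x in (0 : ℝ)..z, g' x := by
    ext z
    rw [← (h.abs_cont 0 z).2]; ring
  rw [h2]
  exact continuous_const.add h1

theorem measurable_deriv (h : HasSixthMoment g g') : Measurable g' := by
  have : g' = fun z => -(score g g' z * g z) := funext h.deriv_eq
  rw [this]
  exact (h.monotone_score.measurable.mul h.continuous.measurable).neg

/-- Where the score is continuous so is g' = -φg, and the fundamental theorem of calculus applies. A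
monotone score fails to be continuous at only countably many points. -/
theorem hasDerivAt (h : HasSixthMoment g g') {z : ℝ} (hz : ContinuousAt (score g g') z) :
    HasDerivAt g (g' z) z := by
  have hc : ContinuousAt g' z := by
    have : g' = fun z => -(score g g' z * g z) := funext h.deriv_eq
    rw [this]
    exact (hz.mul h.continuous.continuousAt).neg
  have h1 := intervalIntegral.integral_hasDerivAt_right (h.abs_cont 0 z).1
    h.measurable_deriv.stronglyMeasurable.stronglyMeasurableAtFilter hc
  have h2 : g = fun z => g 0 + ∫ x in (0 : ℝ)..z, g' x := by
    ext z
    rw [← (h.abs_cont 0 z).2]; ring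
  rw [h2]
  exact h1.const_add _

/-- Since g' is only a version of the derivative, oddness is obtained by differentiating g(-z) =
g(z) at points where the score is continuous at both z and -z. -/
theorem deriv_neg_ae (h : HasSixthMoment g g') : ∀ᵐ z, g' (-z) = -g' z := by
  have hc := h.monotone_score.countable_not_continuousAt
  have hc2 : {z | ¬ContinuousAt (score g g') (-z)}.Countable :=
    hc.preimage (f := fun z : ℝ => -z) neg_injective
  filter_upwards [hc.ae_notMem volume, hc2.ae_notMem volume] with z h1 h2
  simp only [not_not] at h1 h2
  have d1 := h.hasDerivAt h1
  have d2 := (h.hasDerivAt h2).comp z (hasDerivAt_neg z)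
  have e : g ∘ (fun z => -z) = g := funext h.symm
  have d3 : HasDerivAt g (g' (-z) * -1) z := by
    rw [← e]; exact d2
  have := d1.unique d3
  linarith

theorem integrable_pow_mul (h : HasSixthMoment g g') {k : ℕ} (hk : k ≤ 6) :
    Integrable fun z => z ^ k * g z := by
  refine (h.integrable.add h.sixth).mono'
    ((measurable_id.pow_const k).mul h.continuous.measurable).aestronglyMeasurable
    (ae_of_all _ fun z => ?_)
  have hp := (h.pos z).le
  rw [norm_mul, Real.norm_eq_abs, Real.norm_eq_abs, abs_of_nonneg hp, abs_pow]
  have h6 : z ^ 6 = |z| ^ 6 := by rw [← abs_pow, abs_of_nonneg (by positivity)]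
  have h1 : |z| ^ k ≤ 1 + z ^ 6 := by
    rw [h6]
    rcases le_total |z| 1 with h1 | h1
    · have := pow_le_one₀ (n := k) (abs_nonneg z) h1
      have : 0 ≤ |z| ^ 6 := by positivity
      linarith
    · have := pow_le_pow_right₀ h1 hk
      linarith
  simp only [Pi.add_apply]
  nlinarith

/-- On [-1, 1] the monotone score is controlled by its values at ±1. Outside, |z|ᵏ|φ| ≤ |z|³ ·
z²|φ|, and the arithmetic-geometric mean inequality bounds this by the integrands of the sixth
moment and the information for asymmetry. -/
theorem integrable_pow_mul_deriv (h : HasSixthMoment g g') {k : ℕ} (hk : k ≤ 5) :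
    Integrable fun z => z ^ k * g' z := by
  set C := |score g g' 1| + |score g g' (-1)| with hC
  refine (((h.integrable.const_mul C).add h.sixth).add h.finite_info).mono'
    ((measurable_id.pow_const k).mul h.measurable_deriv).aestronglyMeasurable
    (ae_of_all _ fun z => ?_)
  have hp := (h.pos z).le
  rw [h.deriv_eq, norm_mul, norm_neg, norm_mul, Real.norm_eq_abs, Real.norm_eq_abs,
    Real.norm_eq_abs, abs_of_nonneg hp, abs_pow]
  have h6 : z ^ 6 = |z| ^ 6 := by rw [← abs_pow, abs_of_nonneg (by positivity)]
  have h4 : z ^ 4 = |z| ^ 4 := by rw [← abs_pow, abs_of_nonneg (by positivity)]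
  have hs : score g g' z ^ 2 = |score g g' z| ^ 2 := (sq_abs _).symm
  have h1 : |z| ^ k * |score g g' z| ≤ C + z ^ 6 + z ^ 4 * score g g' z ^ 2 := by
    rw [h6, h4, hs]
    have hsnn := abs_nonneg (score g g' z)
    rcases le_total |z| 1 with h1 | h1
    · have h2 := pow_le_one₀ (n := k) (abs_nonneg z) h1
      obtain ⟨ha, hb⟩ := abs_le.1 h1
      have h3 : |score g g' z| ≤ C := by
        have m1 := h.monotone_score ha
        have m2 := h.monotone_score hb
        rw [abs_le]
        constructor
        · have := neg_abs_le (score g g' (-1))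
          have := abs_nonneg (score g g' 1)
          linarith
        · have := le_abs_self (score g g' 1)
          have := abs_nonneg (score g g' (-1))
          linarith
      have : |z| ^ k * |score g g' z| ≤ 1 * |score g g' z| :=
        mul_le_mul_of_nonneg_right h2 hsnn
      have : 0 ≤ |z| ^ 6 := by positivity
      have : 0 ≤ |z| ^ 4 * |score g g' z| ^ 2 := by positivity
      linarith
    · have h2 : |z| ^ k ≤ |z| ^ 5 := pow_le_pow_right₀ h1 hk
      have h3 := mul_le_mul_of_nonneg_right h2 hsnn
      have h5 : 2 * (|z| ^ 5 * |score g g' z|) ≤ |z| ^ 6 + |z| ^ 4 * |score g g' z| ^ 2 := by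
        have := two_mul_le_add_sq (|z| ^ 3) (|z| ^ 2 * |score g g' z|)
        nlinarith
      have : 0 ≤ C := by positivity
      have : 0 ≤ |z| ^ 5 * |score g g' z| := by positivity
      linarith
  simp only [Pi.add_apply]
  nlinarith

/-- Integration by parts against odd powers. -/
theorem integral_pow_mul_neg_deriv (h : HasSixthMoment g g') {k : ℕ} (hk : k ≤ 5) (hodd : Odd k) :
    ∫ z, z ^ k * -g' z = k * moment (k - 1) g := by
  have i1 : Integrable fun z => (k * z ^ (k - 1)) * g z := by
    have := (h.integrable_pow_mul (k := k - 1) (by omega)).const_mul (k : ℝ)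
    refine this.congr (ae_of_all _ fun z => ?_)
    ring
  have i2 := h.integrable_pow_mul_deriv hk
  have hi : Integrable fun z => (k * z ^ (k - 1)) * g z + z ^ k * g' z := i1.add i2
  have hbd : ∀ R : ℝ, ∫ z in (-R)..R, ((k * z ^ (k - 1)) * g z + z ^ k * g' z) =
      2 * (R ^ k * g R) := fun R => by
    -- The primitive zᵏg is continuous and differentiable off the countable set of jumps of the
    -- score.
    rw [integral_eq_of_hasDerivAt_off_countable (fun z => z ^ k * g z) _
      h.monotone_score.countable_not_continuousAt
      ((continuous_id.pow k).mul h.continuous).continuousOn ?_ hi.intervalIntegrable]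
    · rw [hodd.neg_pow, h.symm]; ring
    · intro x hx
      have hx2 : ContinuousAt (score g g') x := by
        by_contra hc
        exact hx.2 hc
      exact (hasDerivAt_pow k x).mul (h.hasDerivAt hx2)
  have hlim := intervalIntegral_tendsto_integral hi tendsto_neg_atTop_atBot
    (tendsto_id (α := ℝ) (x := atTop))
  simp only [id, hbd] at hlim
  -- The boundary term 2Rᵏg(R) has a limit, being a convergent integral over [-R, R]; being also
  -- integrable in R, it can only tend to 0.
  have hz := IntegrableAtFilter.eq_zero_of_tendsto (μ := volume) (l := (atTop : Filter ℝ))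
    (f := fun R => 2 * (R ^ k * g R))
    (((h.integrable_pow_mul (k := k) (by omega)).const_mul 2).integrableAtFilter _) ?_ hlim
  · rw [integral_add i1 i2] at hz
    have e1 : ∫ z, (k * z ^ (k - 1)) * g z = k * moment (k - 1) g := by
      rw [moment, ← integral_const_mul]
      congr 1; ext z; ring
    have e2 : ∫ z, z ^ k * -g' z = -∫ z, z ^ k * g' z := by
      rw [← integral_neg]
      congr 1; ext z; ring
    rw [e2]
    linarith
  · intro s hs
    obtain ⟨b, hb⟩ := mem_atTop_sets.1 hs
    rw [← top_le_iff, ← Real.volume_Ici (a := b)]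
    exact measure_mono hb

theorem integral_odd_eq_zero (h : HasSixthMoment g g') {w : ℝ → ℝ} (hw : ∀ z, w (-z) = -w z) :
    ∫ z, w z * g z = 0 := by
  have h1 := integral_neg_eq_self (fun z => w z * g z) volume
  have h2 : ∫ z, w (-z) * g (-z) = -∫ z, w z * g z := by
    rw [← integral_neg]
    congr 1; ext z; rw [hw, h.symm]; ring
  linarith

end HasSixthMoment

/-- The Gaussian score is a z, so the cross-information integrand is a² z⁶ g. -/
theorem IsRegularFor.hasSixthMoment {a : ℝ} (ha : 0 < a) {g g' : ℝ → ℝ}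
    (h : IsRegularFor (gaussDensity a) (deriv (gaussDensity a)) g g')
    (hs : ∀ z, score (gaussDensity a) (deriv (gaussDensity a)) z = a * z) :
    HasSixthMoment g g' where
  pos := h.pos
  integrable := h.integrable
  integral_eq_one := h.integral_eq_one
  symm := h.symm
  abs_cont := h.abs_cont
  monotone_score := h.strongly_unimodal
  finite_info := h.finite_info
  sixth := by
    have := h.finite_crossInfo.const_mul (a ^ 2)⁻¹
    refine this.congr (ae_of_all _ fun z => ?_)
    simp only [hs]
    field_simp

/-! ### Local Edgeworth alternatives -/

theorem edgeworthDensity_eq_standard (f f' : ℝ → ℝ) (θ σ ξ x : ℝ) :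
    edgeworthDensity f f' θ σ ξ x = σ⁻¹ * edgeworthDensity f f' 0 1 ξ ((x - θ) / σ) := by
  simp [edgeworthDensity]

/-- The truncated perturbation of `g` in the standard Edgeworth density. -/
noncomputable def perturbation (g g' : ℝ → ℝ) (ξ x : ℝ) : ℝ :=
  max (-g x) (min (g x) (-ξ * g' x * (x ^ 2 - kappa g g')))

theorem edgeworthDensity_zero_one (g g' : ℝ → ℝ) (ξ x : ℝ) :
    edgeworthDensity g g' 0 1 ξ x = g x + perturbation g g' ξ x := by
  simp [edgeworthDensity, perturbation]

/-! ### Size, symmetry and first-order effect of the perturbation. -/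

namespace HasSixthMoment

variable {g g' : ℝ → ℝ}

theorem measurable_perturbation (h : HasSixthMoment g g') (ξ : ℝ) :
    Measurable (perturbation g g' ξ) := by
  have := h.continuous.measurable
  have := h.measurable_deriv
  unfold perturbation
  fun_prop

theorem measurable_edgeworthDensity (h : HasSixthMoment g g') (ξ : ℝ) :
    Measurable (edgeworthDensity g g' 0 1 ξ) :=
  funext (edgeworthDensity_zero_one g g' ξ) ▸
    h.continuous.measurable.add (h.measurable_perturbation ξ)

theorem abs_perturbation_le (h : HasSixthMoment g g') (ξ x : ℝ) :
    |perturbation g g' ξ x| ≤ g x := by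
  have := (h.pos x).le
  rw [perturbation, abs_le]
  exact ⟨le_max_left _ _, max_le (by linarith) (min_le_left _ _)⟩

/-- Truncating to an interval symmetric about 0 cannot increase the absolute value. This gives the
order-ξ majorant, while `abs_perturbation_le` gives the bounds 0 and 2g on the density. -/
theorem abs_perturbation_le' (h : HasSixthMoment g g') (ξ x : ℝ) :
    |perturbation g g' ξ x| ≤ |-ξ * g' x * (x ^ 2 - kappa g g')| := by
  have hp := (h.pos x).le
  rw [perturbation, abs_le]
  set c := -ξ * g' x * (x ^ 2 - kappa g g')
  have h1 := neg_abs_le c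
  have h2 := le_abs_self c
  have h3 := abs_nonneg c
  constructor
  · rcases le_total (g x) c with h4 | h4
    · exact le_trans (by linarith) (le_max_right _ _) |>.trans' (by rw [min_eq_left h4]; linarith)
    · exact le_trans h1 (le_max_right _ _ |>.trans' (by rw [min_eq_right h4]))
  · exact max_le (by linarith) ((min_le_right _ _).trans h2)

theorem perturbation_eq {ξ x : ℝ}
    (hle : |-ξ * g' x * (x ^ 2 - kappa g g')| ≤ g x) :
    perturbation g g' ξ x = -ξ * g' x * (x ^ 2 - kappa g g') := by
  obtain ⟨h1, h2⟩ := abs_le.1 hle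
  rw [perturbation, min_eq_right h2, max_eq_right h1]

theorem integrable_perturbation (h : HasSixthMoment g g') (ξ : ℝ) :
    Integrable (perturbation g g' ξ) :=
  h.integrable.mono' (h.measurable_perturbation ξ).aestronglyMeasurable
    (ae_of_all _ fun x => h.abs_perturbation_le ξ x)

/-- The perturbation is odd almost everywhere, so total mass stays one without renormalization. -/
theorem integral_perturbation (h : HasSixthMoment g g') (ξ : ℝ) :
    ∫ x, perturbation g g' ξ x = 0 := by
  have h1 := integral_neg_eq_self (perturbation g g' ξ) volume
  have h2 : ∫ x, perturbation g g' ξ (-x) = -∫ x, perturbation g g' ξ x := by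
    rw [← integral_neg]
    refine integral_congr_ae ?_
    filter_upwards [h.deriv_neg_ae] with x hx
    have e : -ξ * -g' x * ((-x) ^ 2 - kappa g g') = -(-ξ * g' x * (x ^ 2 - kappa g g')) := by ring
    simp only [perturbation, hx, h.symm, e]
    set c := -ξ * g' x * (x ^ 2 - kappa g g')
    have hp := (h.pos x).le
    -- Truncation to [-g, g] commutes with negation.
    grind
  linarith

theorem dominatedDensities (h : HasSixthMoment g g') {ξ : ℕ → ℝ} (hξ : Tendsto ξ atTop (𝓝 0)) :
    DominatedDensities g fun n => edgeworthDensity g g' 0 1 (ξ n) where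
  integrable := h.integrable
  measurable n := h.measurable_edgeworthDensity (ξ n)
  nonneg n x := by
    rw [edgeworthDensity_zero_one]
    linarith [(abs_le.1 (h.abs_perturbation_le (ξ n) x)).1]
  le n x := by
    rw [edgeworthDensity_zero_one]
    linarith [(abs_le.1 (h.abs_perturbation_le (ξ n) x)).2]
  tendsto x := by
    simp only [edgeworthDensity_zero_one]
    have h1 : Tendsto (fun n => |-ξ n * g' x * (x ^ 2 - kappa g g')|) atTop (𝓝 0) := by
      have := ((hξ.neg.mul_const (g' x)).mul_const (x ^ 2 - kappa g g')).abs
      simpa using this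
    have h2 := squeeze_zero_norm (f := fun n => perturbation g g' (ξ n) x)
      (fun n => h.abs_perturbation_le' (ξ n) x) h1
    simpa using h2.const_add (g x)
  integral_eq_one n := by
    simp only [edgeworthDensity_zero_one]
    rw [integral_add h.integrable (h.integrable_perturbation _), h.integral_perturbation,
      h.integral_eq_one, add_zero]

/-- Means of odd statistics under local alternatives. -/
theorem tendsto_sqrt_mul_integral (h : HasSixthMoment g g') {N : ℕ → ℕ} {ξ : ℕ → ℝ} {τ : ℝ}
    (hξ : Tendsto ξ atTop (𝓝 0))
    (hτ : Tendsto (fun n => Real.sqrt (N n) * ξ n) atTop (𝓝 τ))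
    {w : ℝ → ℝ} (hw : Measurable w) (hodd : ∀ z, w (-z) = -w z)
    (hi : Integrable fun z => w z * g z)
    (hd : Integrable fun z => w z * (z ^ 2 - kappa g g') * g' z) :
    Tendsto (fun n => Real.sqrt (N n) *
      ∫ x, w x ∂(densityMeasure (edgeworthDensity g g' 0 1 (ξ n)))) atTop
      (𝓝 (τ * ∫ z, w z * (z ^ 2 - kappa g g') * -g' z)) := by
  have hD := h.dominatedDensities hξ
  have ip : ∀ n, Integrable fun x => w x * perturbation g g' (ξ n) x := fun n => by
    refine hi.norm.mono' (hw.mul (h.measurable_perturbation _)).aestronglyMeasurable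
      (ae_of_all _ fun x => ?_)
    rw [norm_mul, norm_mul, Real.norm_eq_abs (g x), abs_of_pos (h.pos x)]
    exact mul_le_mul_of_nonneg_left (h.abs_perturbation_le _ x) (norm_nonneg _)
  have e : ∀ n, Real.sqrt (N n) *
      ∫ x, w x ∂(densityMeasure (edgeworthDensity g g' 0 1 (ξ n))) =
      ∫ x, Real.sqrt (N n) * (w x * perturbation g g' (ξ n) x) := fun n => by
    rw [integral_densityMeasure (hD.measurable n) (hD.nonneg n), integral_const_mul]
    congr 1
    have : ∀ x, edgeworthDensity g g' 0 1 (ξ n) x • w x =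
        w x * g x + w x * perturbation g g' (ξ n) x := fun x => by
      rw [edgeworthDensity_zero_one, smul_eq_mul]; ring
    simp only [this]
    -- The term of order √N disappears because w is odd and g even.
    rw [integral_add hi (ip n), h.integral_odd_eq_zero hodd, zero_add]
  simp only [e]
  rw [← integral_const_mul]
  -- The majorant uses that |√N ξ| is eventually at most |τ| + 1.
  refine tendsto_integral_filter_of_dominated_convergence
    (fun x => (|τ| + 1) * ‖w x * (x ^ 2 - kappa g g') * g' x‖)
    (Eventually.of_forall fun n =>
      (measurable_const.mul (hw.mul (h.measurable_perturbation _))).aestronglyMeasurable)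
    ?_ (hd.norm.const_mul _) (ae_of_all _ fun x => ?_)
  · have hb := hτ.abs.eventually_le_const (lt_add_one |τ|)
    filter_upwards [hb] with n hn
    refine ae_of_all _ fun x => ?_
    have h1 := h.abs_perturbation_le' (ξ n) x
    simp only [norm_mul, Real.norm_eq_abs, abs_mul, abs_neg] at h1 hn ⊢
    calc |Real.sqrt (N n)| * (|w x| * |perturbation g g' (ξ n) x|)
        ≤ |Real.sqrt (N n)| * (|w x| * (|ξ n| * |g' x| * |x ^ 2 - kappa g g'|)) := by gcongr
      _ = (|Real.sqrt (N n)| * |ξ n|) * (|w x| * |x ^ 2 - kappa g g'| * |g' x|) := by ring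
      _ ≤ _ := by gcongr
  · have h1 : Tendsto (fun n => |-ξ n * g' x * (x ^ 2 - kappa g g')|) atTop (𝓝 0) := by
      have := ((hξ.neg.mul_const (g' x)).mul_const (x ^ 2 - kappa g g')).abs
      simpa using this
    refine (hτ.mul_const (w x * (x ^ 2 - kappa g g') * -g' x)).congr' ?_
    -- At each fixed x the truncation is eventually inactive, since ξ → 0 and g(x) > 0.
    filter_upwards [h1.eventually_le_const (h.pos x)] with n hn
    rw [perturbation_eq hn]
    ring

end HasSixthMoment

/-! ### Reduction to standard location and scale -/

theorem map_standardize_withDensity {q : ℝ → ℝ} (hq : Measurable q) (θ : ℝ) {σ : ℝ} (hσ : 0 < σ) :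
    (volume.withDensity fun x => ENNReal.ofReal (σ⁻¹ * q ((x - θ) / σ))).map
      (fun x => (x - θ) / σ) = densityMeasure q := by
  have hm : Measurable fun x : ℝ => (x - θ) / σ := by fun_prop
  have hvol : (volume : Measure ℝ).map (fun x => (x - θ) / σ) = ENNReal.ofReal σ • volume := by
    have e : (fun x : ℝ => (x - θ) / σ) = (fun x => σ⁻¹ * x) ∘ fun x => x - θ := by
      ext x; simp [div_eq_inv_mul]
    rw [e, ← Measure.map_map (by fun_prop) (by fun_prop), map_sub_right_eq_self,
      Real.map_volume_mul_left (inv_ne_zero hσ.ne'), inv_inv, abs_of_pos hσ]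
  ext s hs
  rw [Measure.map_apply hm hs, withDensity_apply _ (hm hs), densityMeasure, withDensity_apply _ hs,
    ← setLIntegral_map (f := fun u => ENNReal.ofReal (σ⁻¹ * q u)) hs (by fun_prop) hm, hvol,
    Measure.restrict_smul, lintegral_smul_measure, smul_eq_mul,
    ← lintegral_const_mul _ (by fun_prop)]
  congr 1
  ext u
  rw [← ENNReal.ofReal_mul hσ.le, mul_inv_cancel_left₀ hσ.ne']

namespace HasSixthMoment

variable {g g' : ℝ → ℝ}

theorem isProbabilityMeasure_standard (h : HasSixthMoment g g') (ξ : ℝ) :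
    IsProbabilityMeasure (densityMeasure (edgeworthDensity g g' 0 1 ξ)) := by
  constructor
  have h0 : ∀ x, 0 ≤ edgeworthDensity g g' 0 1 ξ x := fun x => by
    rw [edgeworthDensity_zero_one]
    linarith [(abs_le.1 (h.abs_perturbation_le ξ x)).1]
  have hi : Integrable (edgeworthDensity g g' 0 1 ξ) := by
    rw [funext (edgeworthDensity_zero_one g g' ξ)]
    exact h.integrable.add (h.integrable_perturbation ξ)
  rw [densityMeasure, withDensity_apply _ MeasurableSet.univ, Measure.restrict_univ,
    ← ofReal_integral_eq_lintegral_ofReal hi (ae_of_all _ h0)]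
  simp only [edgeworthDensity_zero_one]
  rw [integral_add h.integrable (h.integrable_perturbation _), h.integral_perturbation,
    h.integral_eq_one, add_zero, ENNReal.ofReal_one]

theorem map_standardize (h : HasSixthMoment g g') (θ : ℝ) {σ : ℝ} (hσ : 0 < σ) (ξ : ℝ) :
    (volume.withDensity fun x => ENNReal.ofReal (edgeworthDensity g g' θ σ ξ x)).map
      (fun x => (x - θ) / σ) = densityMeasure (edgeworthDensity g g' 0 1 ξ) := by
  simp only [edgeworthDensity_eq_standard g g' θ σ]
  exact map_standardize_withDensity (h.measurable_edgeworthDensity ξ) θ hσ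

theorem isProbabilityMeasure_withDensity (h : HasSixthMoment g g') (θ : ℝ) {σ : ℝ} (hσ : 0 < σ)
    (ξ : ℝ) : IsProbabilityMeasure
      (volume.withDensity fun x => ENNReal.ofReal (edgeworthDensity g g' θ σ ξ x)) := by
  have := h.isProbabilityMeasure_standard ξ
  rw [← h.map_standardize θ hσ ξ] at this
  -- Total mass is read off from the standardized image.
  exact Measure.isProbabilityMeasure_of_map fun x => (x - θ) / σ

theorem isProbabilityMeasure_law (h : HasSixthMoment g g') (θ : ℝ) {σ : ℝ} (hσ : 0 < σ) (ξ : ℝ)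
    (n : ℕ) : IsProbabilityMeasure (law g g' θ σ ξ n) := by
  have := h.isProbabilityMeasure_withDensity θ hσ ξ
  unfold law
  infer_instance

theorem map_law (h : HasSixthMoment g g') (θ : ℝ) {σ : ℝ} (hσ : 0 < σ) (ξ : ℝ) (n : ℕ) :
    (law g g' θ σ ξ n).map (fun X i => (X i - θ) / σ) =
      Measure.pi fun _ : Fin n => densityMeasure (edgeworthDensity g g' 0 1 ξ) := by
  have := h.isProbabilityMeasure_withDensity θ hσ ξ
  have := h.isProbabilityMeasure_standard ξ
  unfold law
  have hsf : SigmaFinite ((volume.withDensity fun x =>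
      ENNReal.ofReal (edgeworthDensity g g' θ σ ξ x)).map (fun x => (x - θ) / σ)) := by
    rw [h.map_standardize θ hσ ξ]; infer_instance
  have hm : Measurable fun x : ℝ => (x - θ) / σ := by fun_prop
  rw [Measure.pi_map_pi (f := fun _ x => (x - θ) / σ) (fun _ => hm.aemeasurable)]
  simp only [h.map_standardize θ hσ ξ]

end HasSixthMoment

end Edgeworth

namespace Edgeworth

/-! ### The test statistics -/

theorem measurable_empMoment (k : ℕ) (θ : ℝ) (n : ℕ) :
    Measurable fun X : Fin n → ℝ => empMoment k θ X := by
  unfold empMoment; fun_prop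

theorem measurable_statS (θ : ℝ) (n : ℕ) : Measurable (statS θ n) := by
  have := measurable_empMoment 3 θ n
  have := measurable_empMoment 6 θ n
  unfold statS; fun_prop

theorem measurable_statT (θ : ℝ) (n : ℕ) : Measurable (statT θ n) := by
  have := measurable_empMoment 2 θ n
  have := measurable_empMoment 4 θ n
  have := measurable_empMoment 6 θ n
  unfold statT; fun_prop

theorem empMoment_standardize (k : ℕ) (θ : ℝ) {σ : ℝ} (hσ : 0 < σ) {n : ℕ} (X : Fin n → ℝ) :
    empMoment k θ X = σ ^ k * empMoment k 0 fun i => (X i - θ) / σ := by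
  have : ∀ i, (X i - θ) ^ k = σ ^ k * ((X i - θ) / σ - 0) ^ k := fun i => by
    rw [sub_zero, ← mul_pow, mul_div_cancel₀ _ hσ.ne']
  simp only [empMoment, this, ← Finset.mul_sum]
  ring

theorem statS_standardize (θ : ℝ) {σ : ℝ} (hσ : 0 < σ) (n : ℕ) (X : Fin n → ℝ) :
    statS θ n X = statS 0 n fun i => (X i - θ) / σ := by
  unfold statS
  rw [empMoment_standardize 3 θ hσ, empMoment_standardize 6 θ hσ]
  have : Real.sqrt (σ ^ 6) = σ ^ 3 := by
    rw [show σ ^ 6 = (σ ^ 3) ^ 2 by ring, Real.sqrt_sq (by positivity)]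
  rw [Real.sqrt_mul (by positivity), this, mul_left_comm, mul_div_mul_left _ _ (by positivity)]

theorem statT_standardize (θ : ℝ) {σ : ℝ} (hσ : 0 < σ) (n : ℕ) (X : Fin n → ℝ) :
    statT θ n X = statT 0 n fun i => (X i - θ) / σ := by
  unfold statT
  rw [empMoment_standardize 2 θ hσ, empMoment_standardize 4 θ hσ, empMoment_standardize 6 θ hσ]
  set Y := fun i => (X i - θ) / σ with hY
  have hX : ∀ i, X i - θ = σ * Y i := fun i => by rw [hY]; field_simp
  have h6 : Real.sqrt (σ ^ 6) = σ ^ 3 := by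
    rw [show σ ^ 6 = (σ ^ 3) ^ 2 by ring, Real.sqrt_sq (by positivity)]
  have e1 : ∑ i, (X i - θ) * ((X i - θ) ^ 2 - 3 * (σ ^ 2 * empMoment 2 0 Y)) =
      σ ^ 3 * ∑ i, (Y i - 0) * ((Y i - 0) ^ 2 - 3 * empMoment 2 0 Y) := by
    rw [Finset.mul_sum]
    refine Finset.sum_congr rfl fun i _ => ?_
    rw [hX]; ring
  have e2 : (n : ℝ) * (σ ^ 6 * empMoment 6 0 Y - 6 * (σ ^ 2 * empMoment 2 0 Y) *
      (σ ^ 4 * empMoment 4 0 Y) + 9 * (σ ^ 2 * empMoment 2 0 Y) ^ 3) =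
      σ ^ 6 * (n * (empMoment 6 0 Y - 6 * empMoment 2 0 Y * empMoment 4 0 Y
      + 9 * empMoment 2 0 Y ^ 3)) := by ring
  rw [e1, e2, Real.sqrt_mul (by positivity), h6, mul_div_mul_left _ _ (by positivity)]

theorem sqrt_mul_div_self (n : ℕ) (x : ℝ) :
    Real.sqrt n * (x / n) = (Real.sqrt n)⁻¹ * x := by
  rcases Nat.eq_zero_or_pos n with h | h
  · simp [h]
  · have h0 : (0 : ℝ) < n := by exact_mod_cast h
    have h1 : Real.sqrt n ≠ 0 := (Real.sqrt_pos.2 h0).ne'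
    field_simp
    rw [Real.sq_sqrt h0.le, mul_comm]

/-- The difference from a normalized sum is that sum, bounded in probability, times a factor tending
to 0. With x / 0 = 0 the identity is exact even if the empirical sixth moment vanishes. -/
theorem statS_sub (n : ℕ) (X : Fin n → ℝ) {c : ℝ} (hc : 0 < c) :
    statS 0 n X - (Real.sqrt n)⁻¹ * ∑ i, X i ^ 3 / Real.sqrt c =
      ((Real.sqrt n)⁻¹ * ∑ i, X i ^ 3 / Real.sqrt c) *
        (Real.sqrt c / Real.sqrt (empMoment 6 0 X) - 1) := by
  have h1 : Real.sqrt c ≠ 0 := (Real.sqrt_pos.2 hc).ne'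
  have h3 : empMoment 3 0 X = (∑ i, X i ^ 3) / n := by simp [empMoment]
  rw [statS, h3, sqrt_mul_div_self, ← Finset.sum_div]
  field_simp

/-- The first term is the error of studentization. The second is that of replacing 3m by its
empirical counterpart, a vanishing factor times n^{-1/2} ∑ X_i. -/
theorem statT_sub (n : ℕ) (X : Fin n → ℝ) {c : ℝ} (hc : 0 < c) (m : ℝ) :
    statT 0 n X - (Real.sqrt n)⁻¹ * ∑ i, (X i ^ 3 - 3 * m * X i) / Real.sqrt c =
      ((Real.sqrt n)⁻¹ * ∑ i, (X i ^ 3 - 3 * m * X i) / Real.sqrt c) *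
        (Real.sqrt c / Real.sqrt (empMoment 6 0 X - 6 * empMoment 2 0 X * empMoment 4 0 X
          + 9 * empMoment 2 0 X ^ 3) - 1) +
      ((Real.sqrt n)⁻¹ * ∑ i, X i) *
        (-(3 * (empMoment 2 0 X - m)) / Real.sqrt (empMoment 6 0 X -
          6 * empMoment 2 0 X * empMoment 4 0 X + 9 * empMoment 2 0 X ^ 3)) := by
  have h1 : Real.sqrt c ≠ 0 := (Real.sqrt_pos.2 hc).ne'
  have e1 : ∑ i, (X i - 0) * ((X i - 0) ^ 2 - 3 * empMoment 2 0 X) =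
      ∑ i, (X i ^ 3 - 3 * m * X i) + -(3 * (empMoment 2 0 X - m)) * ∑ i, X i := by
    rw [Finset.mul_sum, ← Finset.sum_add_distrib]
    refine Finset.sum_congr rfl fun i _ => ?_
    ring
  rw [statT, e1, Real.sqrt_mul (Nat.cast_nonneg _), ← Finset.sum_div, div_eq_mul_inv, mul_inv]
  field_simp
  ring

/-! ### Limit laws under local alternatives -/

theorem tendsto_zero_of_sqrt_mul {N : ℕ → ℕ} (hN : Tendsto N atTop atTop) {ξ : ℕ → ℝ} {τ : ℝ}
    (hτ : Tendsto (fun n => Real.sqrt (N n) * ξ n) atTop (𝓝 τ)) : Tendsto ξ atTop (𝓝 0) := by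
  have hr : Tendsto (fun n => Real.sqrt (N n)) atTop atTop :=
    Real.tendsto_sqrt_atTop.comp (tendsto_natCast_atTop_atTop.comp hN)
  have := (tendsto_inv_atTop_zero.comp hr).mul hτ
  rw [zero_mul] at this
  refine this.congr' ?_
  filter_upwards [hr.eventually_gt_atTop 0] with n h0
  simp only [Function.comp]
  field_simp

namespace HasSixthMoment

variable {g g' : ℝ → ℝ}

/-- The variance `γ = μ₆ - 6 μ₂ μ₄ + 9 μ₂³` of `Z³ - 3 μ₂ Z`. -/
theorem integral_cubic_sq (h : HasSixthMoment g g') :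
    ∫ z, (z ^ 3 - 3 * moment 2 g * z) ^ 2 * g z =
      moment 6 g - 6 * moment 2 g * moment 4 g + 9 * moment 2 g ^ 3 := by
  have i2 := h.integrable_pow_mul (k := 2) (by norm_num)
  have i4 := h.integrable_pow_mul (k := 4) (by norm_num)
  have e : ∀ z, (z ^ 3 - 3 * moment 2 g * z) ^ 2 * g z =
      z ^ 6 * g z - (6 * moment 2 g) * (z ^ 4 * g z) + (9 * moment 2 g ^ 2) * (z ^ 2 * g z) :=
    fun z => by ring
  simp only [e]
  have i64 : Integrable fun z => z ^ 6 * g z - (6 * moment 2 g) * (z ^ 4 * g z) :=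
    h.sixth.sub (i4.const_mul _)
  rw [integral_add i64 (i2.const_mul _), integral_sub h.sixth (i4.const_mul _),
    integral_const_mul, integral_const_mul]
  simp only [moment]
  ring

theorem integrable_cubic_sq (h : HasSixthMoment g g') (m : ℝ) :
    Integrable fun z => (z ^ 3 - 3 * m * z) ^ 2 * g z := by
  have i2 := h.integrable_pow_mul (k := 2) (by norm_num)
  have i4 := h.integrable_pow_mul (k := 4) (by norm_num)
  refine ((h.sixth.sub (i4.const_mul (6 * m))).add (i2.const_mul (9 * m ^ 2))).congr
    (ae_of_all _ fun z => ?_)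
  simp only [Pi.add_apply, Pi.sub_apply]
  ring

/-- A nonnegative function that vanishes only on a null set has positive expectation. -/
theorem integral_mul_pos (h : HasSixthMoment g g') {p : ℝ → ℝ} (hp : ∀ z, 0 ≤ p z)
    (hi : Integrable fun z => p z * g z) (hz : ∀ᵐ z, p z ≠ 0) : 0 < ∫ z, p z * g z := by
  refine (integral_nonneg fun z => mul_nonneg (hp z) (h.pos z).le).lt_of_ne' fun h0 => ?_
  rw [integral_eq_zero_iff_of_nonneg (fun z => mul_nonneg (hp z) (h.pos z).le) hi] at h0
  have hf : ∀ᵐ z : ℝ, False := by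
    filter_upwards [h0, hz] with z h1 h2
    exact (mul_ne_zero h2 (h.pos z).ne') h1
  obtain ⟨_, hf⟩ := hf.exists
  exact hf

theorem moment_six_pos (h : HasSixthMoment g g') : 0 < moment 6 g := by
  refine h.integral_mul_pos (p := fun z => z ^ 6) (fun z => by positivity) h.sixth ?_
  filter_upwards [(Set.countable_singleton (0 : ℝ)).ae_notMem volume] with z hz
  exact pow_ne_zero _ hz

/-- γ is the second moment of the cubic z³ - 3μ₂z, which vanishes only at 0 and ±√(3μ₂). Positivity
legitimizes the studentization of T†. -/
theorem gamma_pos (h : HasSixthMoment g g') :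
    0 < moment 6 g - 6 * moment 2 g * moment 4 g + 9 * moment 2 g ^ 3 := by
  rw [← h.integral_cubic_sq]
  refine h.integral_mul_pos (p := fun z => (z ^ 3 - 3 * moment 2 g * z) ^ 2)
    (fun z => sq_nonneg _) (h.integrable_cubic_sq _) ?_
  set r := Real.sqrt (3 * moment 2 g) with hr
  have hr2 : r ^ 2 = 3 * moment 2 g := Real.sq_sqrt (mul_nonneg (by norm_num)
    (integral_nonneg fun z => mul_nonneg (sq_nonneg z) (h.pos z).le))
  have hc : ({0, r, -r} : Set ℝ).Countable := (Set.toFinite _).countable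
  filter_upwards [hc.ae_notMem volume] with z hz
  simp only [Set.mem_insert_iff, Set.mem_singleton_iff, not_or] at hz
  rw [← hr2]
  have e : z ^ 3 - r ^ 2 * z = z * ((z - r) * (z + r)) := by ring
  rw [e]
  refine pow_ne_zero _ (mul_ne_zero hz.1 (mul_ne_zero (sub_ne_zero.2 hz.2.1) ?_))
  intro h0
  exact hz.2.2 (by linarith)

/-! ### Asymptotic laws of the empirical moments and of both statistics. -/

section Limits

variable {N : ℕ → ℕ} {ξ : ℕ → ℝ} {τ : ℝ}

theorem tendstoInProb_empMoment (h : HasSixthMoment g g') (hN : Tendsto N atTop atTop)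
    (hξ : Tendsto ξ atTop (𝓝 0)) {k : ℕ} (hk : k ≤ 6) :
    TendstoInProb (fun n => Measure.pi fun _ : Fin (N n) =>
      densityMeasure (edgeworthDensity g g' 0 1 (ξ n)))
      (fun _ X => empMoment k 0 X) (moment k g) := by
  have := fun n => h.isProbabilityMeasure_standard (ξ n)
  refine tendstoInProb_of_charFun (fun n => (measurable_empMoment k 0 _).aemeasurable) fun t => ?_
  have hlim := (h.dominatedDensities hξ).tendsto_charFun_mean hN (w := fun z => z ^ k)
    (by fun_prop) (h.integrable_pow_mul hk) t
  refine hlim.congr fun n => ?_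
  simp only [empMoment, sub_zero, div_eq_inv_mul]

/-- Central limit theorem for odd statistics under local alternatives. -/
theorem tendsto_charFun_sum (h : HasSixthMoment g g') (hN : Tendsto N atTop atTop)
    (hτ : Tendsto (fun n => Real.sqrt (N n) * ξ n) atTop (𝓝 τ))
    {w : ℝ → ℝ} (hw : Measurable w) (hodd : ∀ z, w (-z) = -w z)
    (hi : Integrable fun z => w z * g z) (hi2 : Integrable fun z => w z ^ 2 * g z)
    (hd : Integrable fun z => w z * (z ^ 2 - kappa g g') * g' z) {v : NNReal}
    (hv : ∫ z, w z ^ 2 * g z = v) (t : ℝ) :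
    Tendsto (fun n => charFun ((Measure.pi fun _ : Fin (N n) =>
        densityMeasure (edgeworthDensity g g' 0 1 (ξ n))).map
        fun X => (Real.sqrt (N n))⁻¹ * ∑ i, w (X i)) t) atTop
      (𝓝 (charFun (gaussianReal (τ * ∫ z, w z * (z ^ 2 - kappa g g') * -g' z) v) t)) := by
  have hξ := tendsto_zero_of_sqrt_mul hN hτ
  have := (h.dominatedDensities hξ).tendsto_charFun_sum hN hw hi hi2
    (h.tendsto_sqrt_mul_integral hξ hτ hw hodd hi hd) t
  rw [charFun_gaussianReal]
  rw [hv] at this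
  exact this

theorem integrable_cubic (h : HasSixthMoment g g') (b c : ℝ) :
    Integrable fun z => (b * z ^ 3 - c * z) * g z := by
  have i1 := h.integrable_pow_mul (k := 1) (by norm_num)
  have i3 := h.integrable_pow_mul (k := 3) (by norm_num)
  refine ((i3.const_mul b).sub (i1.const_mul c)).congr (ae_of_all _ fun z => ?_)
  simp only [Pi.sub_apply]
  ring

theorem integrable_cubic_deriv (h : HasSixthMoment g g') (b c κ : ℝ) :
    Integrable fun z => (b * z ^ 3 - c * z) * (z ^ 2 - κ) * g' z := by
  have i1 := h.integrable_pow_mul_deriv (k := 1) (by norm_num)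
  have i3 := h.integrable_pow_mul_deriv (k := 3) (by norm_num)
  have i5 := h.integrable_pow_mul_deriv (k := 5) (by norm_num)
  refine (((i5.const_mul b).sub (i3.const_mul (b * κ + c))).add (i1.const_mul (c * κ))).congr
    (ae_of_all _ fun z => ?_)
  simp only [Pi.sub_apply, Pi.add_apply]
  ring

/-- After expansion, integration by parts replaces the integrals of z, z³, z⁵ against -g' by 1, 3μ₂,
5μ₄. The two-parameter form covers the summands of S₁ and of T†. -/
theorem integral_cubic_deriv (h : HasSixthMoment g g') (b c κ : ℝ) :
    ∫ z, (b * z ^ 3 - c * z) * (z ^ 2 - κ) * -g' z =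
      b * (5 * moment 4 g - 3 * κ * moment 2 g) - c * (3 * moment 2 g - κ) := by
  have i1 := (h.integrable_pow_mul_deriv (k := 1) (by norm_num)).neg
  have i3 := (h.integrable_pow_mul_deriv (k := 3) (by norm_num)).neg
  have i5 := (h.integrable_pow_mul_deriv (k := 5) (by norm_num)).neg
  have m1 := h.integral_pow_mul_neg_deriv (k := 1) (by norm_num) (by decide)
  have m3 := h.integral_pow_mul_neg_deriv (k := 3) (by norm_num) (by decide)
  have m5 := h.integral_pow_mul_neg_deriv (k := 5) (by norm_num) (by decide)
  have m0 : moment 0 g = 1 := by simpa [moment] using h.integral_eq_one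
  simp only [mul_neg] at m1 m3 m5
  norm_num [m0] at m1 m3 m5
  have e : ∀ z, (b * z ^ 3 - c * z) * (z ^ 2 - κ) * -g' z =
      b * -(z ^ 5 * g' z) - (b * κ + c) * -(z ^ 3 * g' z) + (c * κ) * -(z ^ 1 * g' z) :=
    fun z => by ring
  simp only [e]
  rw [integral_add, integral_sub, integral_const_mul, integral_const_mul, integral_const_mul]
  · simp only [integral_neg, pow_one]
    simp only [integral_neg] at m1 m3 m5
    rw [m1, m3, m5]
    ring
  · exact i5.const_mul _
  · exact i3.const_mul _
  · exact (i5.const_mul _).sub (i3.const_mul _)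
  · exact i1.const_mul _

/-- The central limit theorem applies to z³ / √μ₆, of unit variance; the law of large numbers for
the empirical sixth moment and Slutsky's theorem do the rest. -/
theorem tendsto_charFun_statS (h : HasSixthMoment g g') (θ : ℝ) {σ : ℝ} (hσ : 0 < σ)
    (hN : Tendsto N atTop atTop)
    (hτ : Tendsto (fun n => Real.sqrt (N n) * ξ n) atTop (𝓝 τ)) (t : ℝ) :
    Tendsto (fun n => charFun ((law g g' θ σ (ξ n) (N n)).map (statS θ (N n))) t) atTop
      (𝓝 (charFun (gaussianReal (τ * (5 * moment 4 g - 3 * kappa g g' * moment 2 g) /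
        Real.sqrt (moment 6 g)) 1) t)) := by
  have hstd : ∀ n, (law g g' θ σ (ξ n) (N n)).map (statS θ (N n)) =
      (Measure.pi fun _ : Fin (N n) =>
        densityMeasure (edgeworthDensity g g' 0 1 (ξ n))).map (statS 0 (N n)) := fun n => by
    rw [← h.map_law θ hσ, Measure.map_map (measurable_statS _ _) (by fun_prop)]
    congr 1
    ext X
    exact statS_standardize θ hσ _ X
  simp only [hstd]
  have hpr := fun n => h.isProbabilityMeasure_standard (ξ n)
  have hξ := tendsto_zero_of_sqrt_mul hN hτ
  have hc := h.moment_six_pos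
  set c := moment 6 g with hcdef
  have hsc : 0 < Real.sqrt c := Real.sqrt_pos.2 hc
  have hw : ∀ z : ℝ, z ^ 3 / Real.sqrt c = (Real.sqrt c)⁻¹ * z ^ 3 - 0 * z := fun z => by
    field_simp; ring
  have i2 : ∀ z : ℝ, (z ^ 3 / Real.sqrt c) ^ 2 * g z = c⁻¹ * (z ^ 6 * g z) := fun z => by
    rw [div_pow, Real.sq_sqrt hc.le]
    field_simp
  have hA := fun t => h.tendsto_charFun_sum hN hτ (w := fun z => z ^ 3 / Real.sqrt c) (v := 1)
    (by fun_prop) (fun z => by ring)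
    (by simp only [hw]; exact h.integrable_cubic _ _)
    (by simp only [i2]; exact h.sixth.const_mul _)
    (by simp only [hw]; exact h.integrable_cubic_deriv _ _ _)
    (by simp only [i2]; rw [integral_const_mul]; exact inv_mul_cancel₀ hc.ne') t
  have em : τ * ∫ z, z ^ 3 / Real.sqrt c * (z ^ 2 - kappa g g') * -g' z =
      τ * (5 * moment 4 g - 3 * kappa g g' * moment 2 g) / Real.sqrt c := by
    simp only [hw]
    rw [h.integral_cubic_deriv]
    field_simp
    ring
  rw [em] at hA
  have hmA : ∀ n, Measurable fun X : Fin (N n) → ℝ =>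
      (Real.sqrt (N n))⁻¹ * ∑ i, X i ^ 3 / Real.sqrt c := fun n => by fun_prop
  refine tendsto_charFun_of_tendstoInProb_sub hmA (fun n => measurable_statS 0 _) (hA t) ?_
  simp only [statS_sub _ _ hc]
  refine (boundedInProb_of_charFun (fun n => (hmA n).aemeasurable) hA).mul_tendstoInProb ?_
  have h6 := h.tendstoInProb_empMoment hN hξ (k := 6) le_rfl
  have hf : ContinuousAt (fun x => Real.sqrt c / Real.sqrt x - 1) c :=
    (continuousAt_const.div Real.continuous_sqrt.continuousAt hsc.ne').sub continuousAt_const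
  have := h6.comp_continuousAt hf
  rw [div_self hsc.ne', sub_self] at this
  exact this

/-- As for S₁, with the summand (z³ - 3μ₂z) / √γ and the extra error from estimating μ₂. -/
theorem tendsto_charFun_statT (h : HasSixthMoment g g') (θ : ℝ) {σ : ℝ} (hσ : 0 < σ)
    (hN : Tendsto N atTop atTop)
    (hτ : Tendsto (fun n => Real.sqrt (N n) * ξ n) atTop (𝓝 τ)) (t : ℝ) :
    Tendsto (fun n => charFun ((law g g' θ σ (ξ n) (N n)).map (statT θ (N n))) t) atTop
      (𝓝 (charFun (gaussianReal (τ * (5 * moment 4 g - 3 * kappa g g' * moment 2 g -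
        3 * moment 2 g * (3 * moment 2 g - kappa g g')) /
        Real.sqrt (moment 6 g - 6 * moment 2 g * moment 4 g + 9 * moment 2 g ^ 3)) 1) t)) := by
  have hstd : ∀ n, (law g g' θ σ (ξ n) (N n)).map (statT θ (N n)) =
      (Measure.pi fun _ : Fin (N n) =>
        densityMeasure (edgeworthDensity g g' 0 1 (ξ n))).map (statT 0 (N n)) := fun n => by
    rw [← h.map_law θ hσ, Measure.map_map (measurable_statT _ _) (by fun_prop)]
    congr 1
    ext X
    exact statT_standardize θ hσ _ X
  simp only [hstd]
  have hpr := fun n => h.isProbabilityMeasure_standard (ξ n)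
  have hξ := tendsto_zero_of_sqrt_mul hN hτ
  have hc := h.gamma_pos
  have hvar := h.integral_cubic_sq
  obtain ⟨c, hcdef⟩ : ∃ c, c = moment 6 g - 6 * moment 2 g * moment 4 g + 9 * moment 2 g ^ 3 :=
    ⟨_, rfl⟩
  obtain ⟨m, hm⟩ : ∃ m, m = moment 2 g := ⟨_, rfl⟩
  rw [← hcdef] at hc hvar ⊢
  rw [← hm] at hvar
  have hsc : 0 < Real.sqrt c := Real.sqrt_pos.2 hc
  have hw : ∀ z : ℝ, (z ^ 3 - 3 * m * z) / Real.sqrt c =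
      (Real.sqrt c)⁻¹ * z ^ 3 - (3 * m * (Real.sqrt c)⁻¹) * z := fun z => by
    field_simp
  have i2 : ∀ z : ℝ, ((z ^ 3 - 3 * m * z) / Real.sqrt c) ^ 2 * g z =
      c⁻¹ * ((z ^ 3 - 3 * m * z) ^ 2 * g z) := fun z => by
    rw [div_pow, Real.sq_sqrt hc.le]
    field_simp
  have hA := fun t => h.tendsto_charFun_sum hN hτ
    (w := fun z => (z ^ 3 - 3 * m * z) / Real.sqrt c) (v := 1)
    (by fun_prop) (fun z => by ring)
    (by simp only [hw]; exact h.integrable_cubic _ _)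
    (by simp only [i2]; exact (h.integrable_cubic_sq _).const_mul _)
    (by simp only [hw]; exact h.integrable_cubic_deriv _ _ _)
    (by simp only [i2]; rw [integral_const_mul, hvar]; exact inv_mul_cancel₀ hc.ne') t
  have em : τ * ∫ z, (z ^ 3 - 3 * m * z) / Real.sqrt c * (z ^ 2 - kappa g g') * -g' z =
      τ * (5 * moment 4 g - 3 * kappa g g' * moment 2 g -
        3 * moment 2 g * (3 * moment 2 g - kappa g g')) / Real.sqrt c := by
    simp only [hw]
    rw [h.integral_cubic_deriv, hm]
    field_simp
  rw [em] at hA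
  obtain ⟨v, hv⟩ : ∃ v : NNReal, ∫ z, z ^ 2 * g z = v :=
    ⟨⟨m, hm ▸ integral_nonneg fun z => mul_nonneg (sq_nonneg z) (h.pos z).le⟩, hm.symm⟩
  -- This limit law serves only to bound n^{-1/2} ∑ X_i in probability.
  have hA1 := fun t => h.tendsto_charFun_sum hN hτ (w := fun z => z) measurable_id
    (fun z => rfl) (by simpa using h.integrable_pow_mul (k := 1) (by norm_num))
    (h.integrable_pow_mul (k := 2) (by norm_num))
    (by simpa using h.integrable_cubic_deriv 0 (-1) (kappa g g')) hv t
  have hmA : ∀ n, Measurable fun X : Fin (N n) → ℝ =>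
      (Real.sqrt (N n))⁻¹ * ∑ i, (X i ^ 3 - 3 * m * X i) / Real.sqrt c := fun n => by fun_prop
  have hmA1 : ∀ n, Measurable fun X : Fin (N n) → ℝ =>
      (Real.sqrt (N n))⁻¹ * ∑ i, X i := fun n => by fun_prop
  refine tendsto_charFun_of_tendstoInProb_sub hmA (fun n => measurable_statT 0 _) (hA t) ?_
  simp only [statT_sub _ _ hc m]
  have h2 := h.tendstoInProb_empMoment hN hξ (k := 2) (by norm_num)
  have h4 := h.tendstoInProb_empMoment hN hξ (k := 4) (by norm_num)
  have h6 := h.tendstoInProb_empMoment hN hξ (k := 6) le_rfl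
  have hj := h6.prodMk (h2.prodMk h4)
  let p : ℝ × ℝ × ℝ → ℝ := fun x => Real.sqrt (x.1 - 6 * x.2.1 * x.2.2 + 9 * x.2.1 ^ 3)
  have hp : Continuous p := by fun_prop
  have hp0 : p (moment 6 g, moment 2 g, moment 4 g) = Real.sqrt c := by simp only [p, ← hcdef]
  have hf1 : ContinuousAt (fun x => Real.sqrt c / p x - 1)
      (moment 6 g, moment 2 g, moment 4 g) :=
    (continuousAt_const.div hp.continuousAt (hp0 ▸ hsc.ne')).sub continuousAt_const
  have hf2 : ContinuousAt (fun x : ℝ × ℝ × ℝ => -(3 * (x.2.1 - m)) / p x)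
      (moment 6 g, moment 2 g, moment 4 g) :=
    (by fun_prop : Continuous fun x : ℝ × ℝ × ℝ => -(3 * (x.2.1 - m))).continuousAt.div
      hp.continuousAt (hp0 ▸ hsc.ne')
  have hD1 := hj.comp_continuousAt hf1
  have hD2 := hj.comp_continuousAt hf2
  simp only [hp0, div_self hsc.ne', sub_self] at hD1
  simp only [← hm, sub_self, mul_zero, neg_zero, zero_div] at hD2
  have := ((boundedInProb_of_charFun (fun n => (hmA n).aemeasurable) hA).mul_tendstoInProb
    hD1).add ((boundedInProb_of_charFun (fun n => (hmA1 n).aemeasurable) hA1).mul_tendstoInProb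
    hD2)
  simpa [p] using this

end Limits

end HasSixthMoment

end Edgeworth

namespace Edgeworth

/-! ### The Gaussian density -/

theorem hasDerivAt_gaussDensity (a z : ℝ) :
    HasDerivAt (gaussDensity a) (-(a * z) * gaussDensity a z) z := by
  have h1 : HasDerivAt (fun z : ℝ => -(a * z ^ 2 / 2)) (-(a * z)) z := by
    have := (((hasDerivAt_pow 2 z).const_mul a).div_const 2).neg
    convert! this using 1
    push_cast; ring
  have h2 := (h1.exp).const_mul (Real.sqrt (a / (2 * Real.pi)))
  convert! h2 using 1
  simp only [gaussDensity]; ring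

theorem deriv_gaussDensity (a : ℝ) :
    deriv (gaussDensity a) = fun z => -(a * z) * gaussDensity a z :=
  funext fun z => (hasDerivAt_gaussDensity a z).deriv

theorem gaussDensity_pos {a : ℝ} (ha : 0 < a) (z : ℝ) : 0 < gaussDensity a z := by
  have := Real.pi_pos
  unfold gaussDensity; positivity

theorem score_gaussDensity {a : ℝ} (ha : 0 < a) (z : ℝ) :
    score (gaussDensity a) (deriv (gaussDensity a)) z = a * z := by
  have := (gaussDensity_pos ha z).ne'
  rw [deriv_gaussDensity, score]
  field_simp

theorem integrable_pow_mul_gaussDensity {a : ℝ} (ha : 0 < a) (k : ℕ) :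
    Integrable fun z => z ^ k * gaussDensity a z := by
  have h1 := integrable_rpow_mul_exp_neg_mul_sq (b := a / 2) (by positivity) (s := k)
    (by have : (0 : ℝ) ≤ k := Nat.cast_nonneg k
        linarith)
  refine (h1.const_mul (Real.sqrt (a / (2 * Real.pi)))).congr (ae_of_all _ fun z => ?_)
  simp only [Real.rpow_natCast, gaussDensity]
  rw [show -(a / 2) * z ^ 2 = -(a * z ^ 2 / 2) by ring]
  ring

theorem hasSixthMoment_gaussDensity {a : ℝ} (ha : 0 < a)
    (hstd : IsStdSymmDensity (gaussDensity a)) :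
    HasSixthMoment (gaussDensity a) (deriv (gaussDensity a)) where
  pos := hstd.pos
  integrable := hstd.integrable
  integral_eq_one := hstd.integral_eq_one
  symm := hstd.symm
  abs_cont z₁ z₂ := by
    have hc : Continuous (gaussDensity a) := by unfold gaussDensity; fun_prop
    have hc' : Continuous (deriv (gaussDensity a)) := by rw [deriv_gaussDensity]; fun_prop
    refine ⟨hc'.intervalIntegrable _ _, ?_⟩
    rw [intervalIntegral.integral_deriv_eq_sub
      (fun x _ => (hasDerivAt_gaussDensity a x).differentiableAt) (hc'.intervalIntegrable _ _)]
  monotone_score := by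
    intro x y hxy
    rw [score_gaussDensity ha, score_gaussDensity ha]
    exact mul_le_mul_of_nonneg_left hxy ha.le
  finite_info := by
    refine ((integrable_pow_mul_gaussDensity ha 6).const_mul (a ^ 2)).congr
      (ae_of_all _ fun z => ?_)
    simp only [score_gaussDensity ha]
    ring
  sixth := integrable_pow_mul_gaussDensity ha 6

instance nullSingletonClass_gaussianReal_one (m : ℝ) : NullSingletonClass (gaussianReal m 1) :=
  nullSingletonClass_gaussianReal one_ne_zero

/-! ### Gaussian moments, generalized kurtosis and limiting powers. -/

section GaussianMoments

variable {a : ℝ}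

/-- Since -g' = a z g, integration by parts becomes a recursion between even moments. -/
theorem mul_moment_gaussDensity (ha : 0 < a) (hstd : IsStdSymmDensity (gaussDensity a)) {k : ℕ}
    (hk : k ≤ 5) (hodd : Odd k) :
    a * moment (k + 1) (gaussDensity a) = k * moment (k - 1) (gaussDensity a) := by
  rw [← (hasSixthMoment_gaussDensity ha hstd).integral_pow_mul_neg_deriv hk hodd, moment,
    ← integral_const_mul, deriv_gaussDensity]
  congr 1; ext z; ring

theorem moment_two_gaussDensity (ha : 0 < a) (hstd : IsStdSymmDensity (gaussDensity a)) :
    moment 2 (gaussDensity a) = 1 / a := by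
  have h := mul_moment_gaussDensity ha hstd (k := 1) (by norm_num) (by decide)
  have m0 : moment 0 (gaussDensity a) = 1 := by simpa [moment] using hstd.integral_eq_one
  norm_num [m0] at h
  field_simp
  linarith

theorem moment_four_gaussDensity (ha : 0 < a) (hstd : IsStdSymmDensity (gaussDensity a)) :
    moment 4 (gaussDensity a) = 3 / a ^ 2 := by
  have h := mul_moment_gaussDensity ha hstd (k := 3) (by norm_num) (by decide)
  norm_num [moment_two_gaussDensity ha hstd] at h
  field_simp at h ⊢
  linarith

theorem moment_six_gaussDensity (ha : 0 < a) (hstd : IsStdSymmDensity (gaussDensity a)) :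
    moment 6 (gaussDensity a) = 15 / a ^ 3 := by
  have h := mul_moment_gaussDensity ha hstd (k := 5) (by norm_num) (by decide)
  norm_num [moment_four_gaussDensity ha hstd] at h
  field_simp at h ⊢
  linarith

theorem kappa_gaussDensity (ha : 0 < a) (hstd : IsStdSymmDensity (gaussDensity a)) :
    kappa (gaussDensity a) (deriv (gaussDensity a)) = 3 / a := by
  have hI : infoI (gaussDensity a) (deriv (gaussDensity a)) = a ^ 2 * moment 2 (gaussDensity a) := by
    rw [infoI, moment, ← integral_const_mul]
    congr 1; ext z; rw [score_gaussDensity ha]; ring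
  have hJ : infoJ (gaussDensity a) (deriv (gaussDensity a)) = a ^ 2 * moment 4 (gaussDensity a) := by
    rw [infoJ, moment, ← integral_const_mul]
    congr 1; ext z; rw [score_gaussDensity ha]; ring
  rw [kappa, hI, hJ, moment_two_gaussDensity ha hstd, moment_four_gaussDensity ha hstd]
  field_simp

variable {N : ℕ → ℕ} {ξ : ℕ → ℝ} {τ : ℝ}

/-- Limiting power of the `S₁`-test at the Gaussian. -/
theorem tendsto_power_statS_gaussDensity (ha : 0 < a) (hstd : IsStdSymmDensity (gaussDensity a))
    (θ : ℝ) {σ : ℝ} (hσ : 0 < σ) (hN : Tendsto N atTop atTop)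
    (hτ : Tendsto (fun n => Real.sqrt (N n) * ξ n) atTop (𝓝 τ)) (z : ℝ) :
    Tendsto (fun n => (law (gaussDensity a) (deriv (gaussDensity a)) θ σ (ξ n) (N n)).real
      {X | z < statS θ (N n) X}) atTop
      (𝓝 ((gaussianReal (τ * Real.sqrt (12 / (5 * a))) 1).real (Set.Ioi z))) := by
  have hG := hasSixthMoment_gaussDensity ha hstd
  have := fun n => hG.isProbabilityMeasure_law θ hσ (ξ n) (N n)
  have e : τ * (5 * moment 4 (gaussDensity a) - 3 * kappa (gaussDensity a)
      (deriv (gaussDensity a)) * moment 2 (gaussDensity a)) /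
      Real.sqrt (moment 6 (gaussDensity a)) = τ * Real.sqrt (12 / (5 * a)) := by
    rw [moment_two_gaussDensity ha hstd, moment_four_gaussDensity ha hstd,
      moment_six_gaussDensity ha hstd, kappa_gaussDensity ha hstd, mul_div_assoc]
    congr 1
    -- The squared shift is (6/a²)² over the variance 15/a³.
    have hsq : 12 / (5 * a) * (15 / a ^ 3) = (6 / a ^ 2) ^ 2 := by
      field_simp; norm_num
    rw [div_eq_iff (Real.sqrt_pos.2 (by positivity)).ne', ← Real.sqrt_mul (by positivity), hsq,
      Real.sqrt_sq (by positivity)]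
    field_simp; norm_num
  have h := hG.tendsto_charFun_statS θ hσ hN hτ
  rw [e] at h
  exact tendsto_measureReal_gt_of_charFun (fun n => measurable_statS θ (N n)) h z

/-- Limiting power of the `T†`-test at the Gaussian. -/
theorem tendsto_power_statT_gaussDensity (ha : 0 < a) (hstd : IsStdSymmDensity (gaussDensity a))
    (θ : ℝ) {σ : ℝ} (hσ : 0 < σ) (hN : Tendsto N atTop atTop)
    (hτ : Tendsto (fun n => Real.sqrt (N n) * ξ n) atTop (𝓝 τ)) (z : ℝ) :
    Tendsto (fun n => (law (gaussDensity a) (deriv (gaussDensity a)) θ σ (ξ n) (N n)).real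
      {X | z < statT θ (N n) X}) atTop
      (𝓝 ((gaussianReal (τ * Real.sqrt (6 / a)) 1).real (Set.Ioi z))) := by
  have hG := hasSixthMoment_gaussDensity ha hstd
  have := fun n => hG.isProbabilityMeasure_law θ hσ (ξ n) (N n)
  have e : τ * (5 * moment 4 (gaussDensity a) - 3 * kappa (gaussDensity a)
      (deriv (gaussDensity a)) * moment 2 (gaussDensity a) - 3 * moment 2 (gaussDensity a) *
      (3 * moment 2 (gaussDensity a) - kappa (gaussDensity a) (deriv (gaussDensity a)))) /
      Real.sqrt (moment 6 (gaussDensity a) - 6 * moment 2 (gaussDensity a) *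
        moment 4 (gaussDensity a) + 9 * moment 2 (gaussDensity a) ^ 3) =
      τ * Real.sqrt (6 / a) := by
    have hg : 15 / a ^ 3 - 6 * (1 / a) * (3 / a ^ 2) + 9 * (1 / a) ^ 3 = 6 / a ^ 3 := by
      field_simp; norm_num
    rw [moment_two_gaussDensity ha hstd, moment_four_gaussDensity ha hstd,
      moment_six_gaussDensity ha hstd, kappa_gaussDensity ha hstd, mul_div_assoc, hg]
    congr 1
    -- The same numerator 6/a², because 3μ₂ = κ, but with variance γ = 6/a³.
    have hsq : 6 / a * (6 / a ^ 3) = (6 / a ^ 2) ^ 2 := by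
      field_simp
    rw [div_eq_iff (Real.sqrt_pos.2 (by positivity)).ne', ← Real.sqrt_mul (by positivity), hsq,
      Real.sqrt_sq (by positivity)]
    field_simp; norm_num
  have h := hG.tendsto_charFun_statT θ hσ hN hτ
  rw [e] at h
  exact tendsto_measureReal_gt_of_charFun (fun n => measurable_statT θ (N n)) h z

end GaussianMoments

/-! ### Power functions of Gaussian shifts -/

theorem gaussianReal_real_Ioi (m z : ℝ) :
    (gaussianReal m 1).real (Set.Ioi z) = (gaussianReal 0 1).real (Set.Ioi (z - m)) := by
  have h := gaussianReal_map_const_add (μ := 0) (v := 1) m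
  rw [zero_add] at h
  rw [← h, measureReal_def, Measure.map_apply (by fun_prop) measurableSet_Ioi, measureReal_def]
  congr 2
  ext x
  simp [sub_lt_iff_lt_add']

theorem gaussianReal_pos_of_volume_pos {s : Set ℝ} (hs : volume s ≠ 0) :
    0 < (gaussianReal 0 1).real s := by
  refine ENNReal.toReal_pos (fun h => hs ?_) (measure_ne_top _ _)
  exact gaussianReal_absolutelyContinuous' 0 one_ne_zero h

theorem strictAnti_gaussianReal_Ioi :
    StrictAnti fun z => (gaussianReal 0 1).real (Set.Ioi z) := by
  intro x y hxy
  have h1 : Set.Ioi x = Set.Ioc x y ∪ Set.Ioi y := (Set.Ioc_union_Ioi_eq_Ioi hxy.le).symm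
  have h2 := gaussianReal_pos_of_volume_pos (s := Set.Ioc x y) (by simpa using hxy)
  have h3 : (gaussianReal 0 1).real (Set.Ioi x) = (gaussianReal 0 1).real (Set.Ioc x y) +
      (gaussianReal 0 1).real (Set.Ioi y) := by
    rw [h1, measureReal_union _ measurableSet_Ioi]
    exact Set.disjoint_left.2 fun u hu hu' => not_lt.2 hu.2 hu'
  change (gaussianReal 0 1).real (Set.Ioi y) < (gaussianReal 0 1).real (Set.Ioi x)
  linarith

/-- Power determines the shift: strictness separates the two tests, and injectivity gives the "only
if" in the efficiency statement. -/
theorem strictMono_gaussianReal_shift (z : ℝ) :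
    StrictMono fun m => (gaussianReal m 1).real (Set.Ioi z) := by
  intro m m' h
  simp only [gaussianReal_real_Ioi _ z]
  exact strictAnti_gaussianReal_Ioi (by linarith)

theorem gaussianReal_real_Ioi_lt_one (m z : ℝ) : (gaussianReal m 1).real (Set.Ioi z) < 1 := by
  rw [gaussianReal_real_Ioi]
  have h1 := strictAnti_gaussianReal_Ioi (sub_one_lt (z - m))
  exact h1.trans_le measureReal_le_one

/-! ### Tests -/

theorem isTest_rejectAbove {T : (n : ℕ) → (Fin n → ℝ) → ℝ} (hT : ∀ n, Measurable (T n)) (z : ℝ) :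
    IsTest (rejectAbove T z) := by
  refine fun n => ⟨measurable_const.indicator (measurableSet_lt measurable_const (hT n)),
    fun X => ?_⟩
  unfold rejectAbove
  by_cases hX : X ∈ {X | z < T n X}
  · rw [Set.indicator_of_mem hX]; norm_num
  · rw [Set.indicator_of_notMem hX]; norm_num

theorem integral_rejectAbove {T : (n : ℕ) → (Fin n → ℝ) → ℝ} (hT : ∀ n, Measurable (T n)) (z : ℝ)
    (n : ℕ) (P : Measure (Fin n → ℝ)) :
    ∫ X, rejectAbove T z n X ∂P = P.real {X | z < T n X} := by
  unfold rejectAbove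
  rw [integral_indicator_const _ (measurableSet_lt measurable_const (hT n)), smul_eq_mul, mul_one]

theorem tendsto_sqrt_mul_div_sqrt (τ : ℝ) :
    Tendsto (fun n : ℕ => Real.sqrt n * (τ / Real.sqrt n)) atTop (𝓝 τ) := by
  refine tendsto_const_nhds.congr' ?_
  filter_upwards [eventually_gt_atTop 0] with n hn
  have : Real.sqrt n ≠ 0 := (Real.sqrt_pos.2 (by exact_mod_cast hn)).ne'
  field_simp

theorem isAsympNormal_of_charFun {P : (n : ℕ) → Measure (Fin n → ℝ)}
    (hP : ∀ n, IsProbabilityMeasure (P n)) {T : (n : ℕ) → (Fin n → ℝ) → ℝ}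
    (hT : ∀ n, Measurable (T n)) {m : ℝ}
    (h : ∀ t : ℝ, Tendsto (fun n => charFun ((P n).map (T n)) t) atTop
      (𝓝 (charFun (gaussianReal m 1) t))) : IsAsympNormal P T m := by
  refine ⟨hP, fun n => (hT n).aemeasurable, aemeasurable_id, ?_⟩
  refine ProbabilityMeasure.tendsto_iff_tendsto_charFun.2 fun t => ?_
  have := h t
  simpa [Measure.map_id] using this

theorem hasAsympLevel_of_tendsto {a θ α z : ℝ} {T : (n : ℕ) → (Fin n → ℝ) → ℝ}
    (hT : ∀ n, Measurable (T n))
    (h : ∀ g g' : ℝ → ℝ, IsRegularFor (gaussDensity a) (deriv (gaussDensity a)) g g' →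
      ∀ σ > 0, Tendsto (fun n => (law g g' θ σ 0 n).real {X | z < T n X}) atTop (𝓝 α)) :
    HasAsympLevel a θ α (rejectAbove T z) := by
  intro g g' hg σ hσ ε hε
  filter_upwards [(h g g' hg σ hσ).eventually_le_const (lt_add_of_pos_right α hε)] with n hn
  rwa [integral_rejectAbove hT]

/-- The competitor is the T†-test at the same critical value: at σ = τ = 1 its limiting power is
strictly larger. -/
theorem not_isLocallyMostPowerful_statS {a : ℝ} (ha : 0 < a)
    (hstd : IsStdSymmDensity (gaussDensity a)) (θ : ℝ) {α z : ℝ}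
    (hlevel : HasAsympLevel a θ α (rejectAbove (statT θ) z)) :
    ¬IsLocallyMostPowerful a θ α (rejectAbove (statS θ) z) := by
  rintro ⟨-, -, hopt⟩
  have hs : Real.sqrt (12 / (5 * a)) < Real.sqrt (6 / a) := by
    refine Real.sqrt_lt_sqrt (by positivity) ?_
    rw [div_lt_div_iff₀ (by positivity) ha]
    linarith
  have hlt := strictMono_gaussianReal_shift z (by linarith :
    1 * Real.sqrt (12 / (5 * a)) < 1 * Real.sqrt (6 / a))
  simp only at hlt
  have hS := tendsto_power_statS_gaussDensity ha hstd θ one_pos tendsto_id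
    (tendsto_sqrt_mul_div_sqrt 1) z
  have hT := tendsto_power_statT_gaussDensity ha hstd θ one_pos tendsto_id
    (tendsto_sqrt_mul_div_sqrt 1) z
  -- With half the gap as tolerance, optimality would contradict the limits.
  have hε := half_pos (sub_pos.2 hlt)
  have h := hopt _ (isTest_rejectAbove (measurable_statT θ) z) hlevel 1 one_pos 1 one_pos _ hε
  simp only [integral_rejectAbove (measurable_statT θ), integral_rejectAbove (measurable_statS θ)]
    at h
  have := le_of_tendsto_of_tendsto hT (hS.add_const _) h
  linarith

theorem isARE_gaussDensity {a : ℝ} (ha : 0 < a) (hstd : IsStdSymmDensity (gaussDensity a))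
    (θ : ℝ) {σ : ℝ} (hσ : 0 < σ) :
    IsARE (law (gaussDensity a) (deriv (gaussDensity a)) θ σ) (statT θ) (statS θ) (5 / 2) := by
  refine ⟨by norm_num, fun α z hα => ?_⟩
  -- The null hypothesis is the local alternative with τ = 0.
  have h0 : Tendsto (fun n : ℕ => Real.sqrt (id n : ℕ) * (0 : ℝ)) atTop (𝓝 0) := by simp
  refine ⟨?_, ?_, fun τ hτ => ?_⟩
  · simpa [hα] using tendsto_power_statT_gaussDensity ha hstd θ hσ tendsto_id h0 z
  · simpa [hα] using tendsto_power_statS_gaussDensity ha hstd θ hσ tendsto_id h0 z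
  have hmono := strictMono_gaussianReal_shift z
  have h6 : 0 < Real.sqrt (6 / a) := Real.sqrt_pos.2 (by positivity)
  refine ⟨(gaussianReal (τ * Real.sqrt (6 / a)) 1).real (Set.Ioi z), ?_,
    gaussianReal_real_Ioi_lt_one _ _, tendsto_power_statT_gaussDensity ha hstd θ hσ tendsto_id
      (tendsto_sqrt_mul_div_sqrt τ) z, fun N r hr hNr => ?_⟩
  · rw [← hα]
    exact hmono (mul_pos hτ h6)
  have hN : Tendsto N atTop atTop := by
    rw [← tendsto_natCast_atTop_iff (R := ℝ)]
    refine (hNr.pos_mul_atTop hr tendsto_natCast_atTop_atTop).congr' ?_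
    filter_upwards [eventually_gt_atTop 0] with n hn
    have : (n : ℝ) ≠ 0 := by positivity
    field_simp
  -- Relative to its own sample size N ~ rn, the S₁-test faces the local parameter τ√r.
  have hlim : Tendsto (fun n : ℕ => Real.sqrt (N n) * (τ / Real.sqrt n)) atTop
      (𝓝 (τ * Real.sqrt r)) := by
    refine ((Real.continuous_sqrt.continuousAt.tendsto.comp hNr).const_mul τ).congr fun n => ?_
    simp only [Function.comp]
    rw [Real.sqrt_div (Nat.cast_nonneg _)]
    ring
  have hS := tendsto_power_statS_gaussDensity ha hstd θ hσ hN hlim z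
  have hiff : τ * Real.sqrt r * Real.sqrt (12 / (5 * a)) = τ * Real.sqrt (6 / a) ↔ r = 5 / 2 := by
    rw [mul_assoc, mul_right_inj' hτ.ne', ← Real.sqrt_mul hr.le,
      Real.sqrt_inj (by positivity) (by positivity)]
    constructor
    · intro h
      field_simp at h
      linarith
    · rintro rfl
      field_simp
      norm_num
  rw [← hiff]
  constructor
  · intro h
    -- Equal limiting powers force equal shifts, hence the value of r.
    exact hmono.injective (tendsto_nhds_unique hS h)
  · intro h
    rwa [h] at hS

end Edgeworth

theorem proposition3p5 (a : ℝ) (ha : 0 < a)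
    (hstd : Edgeworth.IsStdSymmDensity (Edgeworth.gaussDensity a)) (θ σ : ℝ) (hσ : 0 < σ) :
    (∀ g g' : ℝ → ℝ,
      Edgeworth.IsRegularFor (Edgeworth.gaussDensity a) (deriv (Edgeworth.gaussDensity a)) g g' →
      Edgeworth.IsAsympNormal (Edgeworth.law g g' θ σ 0) (Edgeworth.statS θ) 0 ∧
      ∀ τ : ℝ, Edgeworth.IsAsympNormal
        (fun n => Edgeworth.law g g' θ σ (τ / Real.sqrt n) n) (Edgeworth.statS θ)
        (τ * (5 * Edgeworth.moment 4 g - 3 * Edgeworth.kappa g g' * Edgeworth.moment 2 g) /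
          Real.sqrt (Edgeworth.moment 6 g))) ∧
    (∀ α z : ℝ, (gaussianReal 0 1).real (Set.Ioi z) = α →
      Edgeworth.HasAsympLevel a θ α (Edgeworth.rejectAbove (Edgeworth.statS θ) z) ∧
      ¬ Edgeworth.IsLocallyMostPowerful a θ α
        (Edgeworth.rejectAbove (Edgeworth.statS θ) z)) ∧
    Edgeworth.IsARE
      (Edgeworth.law (Edgeworth.gaussDensity a) (deriv (Edgeworth.gaussDensity a)) θ σ)
      (Edgeworth.statT θ) (Edgeworth.statS θ) (5 / 2) := by
  have hreg := fun g g' h =>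
    Edgeworth.IsRegularFor.hasSixthMoment (g := g) (g' := g') ha h
      (Edgeworth.score_gaussDensity ha)
  have h0 : Tendsto (fun n : ℕ => Real.sqrt (id n : ℕ) * (0 : ℝ)) atTop (𝓝 0) := by simp
  refine ⟨fun g g' hg => ⟨?_, fun τ => ?_⟩, fun α z hα => ⟨?_, ?_⟩,
    Edgeworth.isARE_gaussDensity ha hstd θ hσ⟩
  · refine Edgeworth.isAsympNormal_of_charFun ((hreg g g' hg).isProbabilityMeasure_law θ hσ 0)
      (Edgeworth.measurable_statS θ) fun t => ?_
    simpa using (hreg g g' hg).tendsto_charFun_statS θ hσ tendsto_id h0 t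
  · exact Edgeworth.isAsympNormal_of_charFun
      (fun n => (hreg g g' hg).isProbabilityMeasure_law θ hσ _ n)
      (Edgeworth.measurable_statS θ) fun t =>
        (hreg g g' hg).tendsto_charFun_statS θ hσ tendsto_id
          (Edgeworth.tendsto_sqrt_mul_div_sqrt τ) t
  · refine Edgeworth.hasAsympLevel_of_tendsto (Edgeworth.measurable_statS θ)
      fun g g' hg σ' hσ' => ?_
    have := (hreg g g' hg).isProbabilityMeasure_law θ hσ' 0
    rw [← hα]
    exact Edgeworth.tendsto_measureReal_gt_of_charFun (Edgeworth.measurable_statS θ)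
      (fun t => by simpa using (hreg g g' hg).tendsto_charFun_statS θ hσ' tendsto_id h0 t) z
  · refine Edgeworth.not_isLocallyMostPowerful_statS ha hstd θ
      (Edgeworth.hasAsympLevel_of_tendsto (Edgeworth.measurable_statT θ) fun g g' hg σ' hσ' => ?_)
    have := (hreg g g' hg).isProbabilityMeasure_law θ hσ' 0
    rw [← hα]
    exact Edgeworth.tendsto_measureReal_gt_of_charFun (Edgeworth.measurable_statT θ)
      (fun t => by simpa using (hreg g g' hg).tendsto_charFun_statT θ hσ' tendsto_id h0 t) z
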